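/- Let $\lambda\le\alpha$ be infinite regular cardinals and let $\mathcal C$ be a locally $\lambda$-presentable category. A morphism $f\colon A\to B$ of $\mathcal C$ is called $\alpha$-presentable if it is an $\alpha$-presentable object of the comma category $(A\downarrow\mathcal C)$. An object $K$ is injective with respect to $n\colon A\to B$ if every $u\colon A\to K$ is of the form $u=wn$ for some $w\colon B\to K$. For a class $\mathcal N$ of morphisms, $\mathcal N^{\vartriangle}$ is the class of objects injective with respect to all members of $\mathcal N$; for a class $\mathcal K$ of objects, $\mathcal K^{\triangledown}$ is the class of morphisms with respect to which all members of $\mathcal K$ are injective. Let $\mathcal N^{\Box}$ be the class of morphisms having the right lifting property with respect to all members of $\mathcal N$, and let $\mathrm{Cof}(\mathcal N)$ be the class of all retracts, in the comma categories $(A\downarrow\mathcal C)$, of transfinite compositions of pushouts of members of $\mathcal N$. A full subcategory (class of objects) $\mathcal K$ of $\mathcal C$ is almost reflective if it is closed under retracts and every object $A$ of $\mathcal C$ admits a morphism $r_A\colon A\to A^*$ in $\mathcal K^{\triangledown}$ with $A^*\in\mathcal K$; it is functorially almost reflective if it is closed under retracts and there are a functor $R\colon\mathcal C\to\mathcal C$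 and a natural transformation $r\colon 1_{\mathcal C}\to R$ with $R(A)\in\mathcal K$ and $r_A\in\mathcal K^{\triangledown}$ for all $A$. Let $\mathcal K$ be an almost reflective subcategory of $\mathcal C$ which is an $\alpha_m$-injectivity class, i.e. $\mathcal K=\mathcal M^{\vartriangle}$ for some class (not necessarily a set) $\mathcal M$ of $\alpha$-presentable morphisms. Then there is a class $\mathcal N$ of $\alpha$-presentable morphisms such that $(\mathrm{Cof}(\mathcal N),\mathcal N^{\Box})$ is a weak factorization system (each of the two classes is determined by the other through the lifting property, and every morphism factors as a member of $\mathrm{Cof}(\mathcal N)$ followed by a member of $\mathcal N^{\Box}$), these factorizations can be chosen functorially on the category of arrows of $\mathcal C$, and $\mathcal K=\mathcal N^{\vartriangle}$. In particular, $\mathcal K$ is functorially almost reflective. -/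

import Mathlib

open CategoryTheory

universe w u

namespace WeakReflection

variable {C : Type u} [Category.{w} C]

/-- The class `N^△` of all objects `K` that are injective with respect to every morphism
of `N`: every `u : A ⟶ K` extends along every `n : A ⟶ B` in `N`. -/
def injectives (N : MorphismProperty C) : ObjectProperty C :=
  fun K ↦ ∀ ⦃A B : C⦄ (n : A ⟶ B), N n → ∀ u : A ⟶ K, ∃ v : B ⟶ K, n ≫ v = u

/-- The class `K^▽` of all morphisms with respect to which every object of `K` is injective. -/
def injectors (K : ObjectProperty C) : MorphismProperty C :=
  fun A B n ↦ ∀ ⦃X : C⦄, K X → ∀ u : A ⟶ X, ∃ v : B ⟶ X, n ≫ v = u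

/-- The class of all `κ`-presentable morphisms: a morphism `f : A ⟶ B` is `κ`-presentable if it
is a `κ`-presentable object of the comma category `(A ↓ C)`. -/
def presentableMorphisms (C : Type u) [Category.{w} C] (κ : Cardinal.{w}) [Fact κ.IsRegular] :
    MorphismProperty C :=
  fun _ _ f ↦ IsCardinalPresentable (Under.mk f) κ

/-- `K` is a `κ_m`-injectivity class: `K = M^△` for some (possibly large) class `M` of
`κ`-presentable morphisms. -/
def IsMorphismInjectivityClass (κ : Cardinal.{w}) [Fact κ.IsRegular] (K : ObjectProperty C) :
    Prop :=
  ∃ M : MorphismProperty C, M ≤ presentableMorphisms C κ ∧ K = injectives M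

/-- `Re(N)`: the retracts, in the comma categories `(A ↓ C)`, of the morphisms of `N` with
domain `A`. -/
def underRetracts (N : MorphismProperty C) : MorphismProperty C :=
  fun A _ f ↦ ∃ (B : C) (g : A ⟶ B), N g ∧ Nonempty (Retract (Under.mk f) (Under.mk g))

/-- `Cof(N)`, the cofibrations of `N`: the retracts of (small) transfinite compositions of pushouts
of morphisms of `N`. -/
def cofibrations (N : MorphismProperty C) : MorphismProperty C :=
  underRetracts (MorphismProperty.transfiniteCompositions.{w} N.pushouts)

/-- The full subcategory `K` is almost reflective: closed under retracts, and weakly reflective,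
i.e. every object `A` has a morphism `r : A ⟶ A'` in `K^▽` with `A'` in `K`. -/
def IsAlmostReflective (K : ObjectProperty C) : Prop :=
  K.IsStableUnderRetracts ∧ ∀ A : C, ∃ (A' : C) (r : A ⟶ A'), K A' ∧ injectors K r

/-- The full subcategory `K` is functorially almost reflective: closed under retracts, and the
weak reflections can be chosen to be the components of a natural transformation from the identity
to an endofunctor of `C`. -/
def IsFunctoriallyAlmostReflective (K : ObjectProperty C) : Prop :=
  K.IsStableUnderRetracts ∧
    ∃ (R : C ⥤ C) (r : 𝟭 C ⟶ R), ∀ A : C, K (R.obj A) ∧ injectors K (r.app A)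

end WeakReflection

/-!
Let `K` be the class of injectives of a possibly large class `M` of `α`-presentable morphisms, and
let `N` be the class of *all* `α`-presentable morphisms with respect to which the objects of `K` are
injective. Then `M ≤ N`, so `K` is also the class of injectives of `N`, and it remains to factor
every morphism functorially as a transfinite composition of members of `N` followed by a morphism
with the right lifting property against `N`. The retract argument then gives the weak factorization
system, and factoring the morphisms to the terminal object gives functorial weak reflections.

Since `N` is a proper class, the usual small object argument does not apply. Two facts replace it.

* `exists_isPushout_of_presentableMorphisms`: an `α`-presentable morphism is a pushout of a morphism
  between `α`-presentable objects. Up to isomorphism there is only a set of the latter, say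
  `p t : P t ⟶ R t`. So over each object `X` there is only a set of members of `N` up to isomorphism,
  namely the pushouts of the `p t` along morphisms `a : P t ⟶ X` that belong to `injectors K`.
  Unlike in the usual argument, which pairs `(t, a)` are admissible depends on `a`; as `injectors K`
  is stable under cobase change, admissible cells are still functorial in the arrow (`Cell.map`).

* `hasFunctorialFactorization_of_cells`: attaching all admissible cells `α` times yields a morphism
  with the right lifting property. Indeed, a cell over the colimit of the chain comes from a stage
  `j`, since `P t` is `α`-presentable. It is admissible at `j`, since the morphism from the stage `j`
  to the colimit lies in `injectors K` and `injectors K` is left cancellable (`f ≫ g` in it forces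
  `f` in it). Hence the cell has been attached at the next stage.

It remains to see that the first factor is a transfinite composition of members of `N`. Attaching a
set of cells at once is a transfinite composition of attachments of single cells
(`transfiniteCompositionsOfShape_attachBase`), and a transfinite composition of transfinite
compositions is a transfinite composition (`transfiniteCompositions_of_lex`), by means of the
lexicographic product of the index types.
-/

namespace WeakReflection

open Limits

variable {C : Type u} [Category.{w} C]

/-! ### Continuous chains -/

/-- A chain of morphisms indexed by a preorder is well-order-continuous as soon as, at every limit
element, compatible families of morphisms out of the earlier stages extend uniquely. -/
lemma isWellOrderContinuous_of_existsUnique {J : Type w} [PartialOrder J] (F : J ⥤ C)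
    (h : ∀ (m : J), Order.IsSuccLimit m → ∀ (Z : C) (k : ∀ j, j < m → (F.obj j ⟶ Z)),
      (∀ i j (hij : i ≤ j) (hj : j < m),
        F.map (homOfLE hij) ≫ k j hj = k i (hij.trans_lt hj)) →
      ∃! l : F.obj m ⟶ Z, ∀ j (hj : j < m), F.map (homOfLE hj.le) ≫ l = k j hj) :
    F.IsWellOrderContinuous where
  nonempty_isColimit m hm := by
    have h' (c : Cocone ((Set.principalSegIio m).monotone.functor ⋙ F)) :=
      h m hm c.pt (fun j hj ↦ c.ι.app ⟨j, hj⟩) (fun i j hij hj ↦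
        c.w (homOfLE hij : (⟨i, hij.trans_lt hj⟩ : Set.Iio m) ⟶ ⟨j, hj⟩))
    exact ⟨
      { desc c := (h' c).choose
        fac c j := (h' c).choose_spec.1 j.1 j.2
        uniq c f hf := (h' c).choose_spec.2 f (fun j hj ↦ hf ⟨j, hj⟩) }⟩

/-- At a limit element of a well-order-continuous chain, compatible families of morphisms out of
the earlier stages extend uniquely. -/
lemma existsUnique_of_isWellOrderContinuous {J : Type w} [PartialOrder J] (F : J ⥤ C)
    [F.IsWellOrderContinuous] (m : J) (hm : Order.IsSuccLimit m) (Z : C)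
    (k : ∀ j, j < m → (F.obj j ⟶ Z))
    (hk : ∀ i j (hij : i ≤ j) (hj : j < m),
      F.map (homOfLE hij) ≫ k j hj = k i (hij.trans_lt hj)) :
    ∃! l : F.obj m ⟶ Z, ∀ j (hj : j < m), F.map (homOfLE hj.le) ≫ l = k j hj := by
  have hc := F.isColimitOfIsWellOrderContinuous m hm
  let c : Cocone ((Set.principalSegIio m).monotone.functor ⋙ F) :=
    { pt := Z
      ι :=
        { app j := k j.1 j.2
          naturality i j φ := (hk i.1 j.1 (leOfHom φ) j.2).trans (Category.comp_id _).symm } }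
  exact ⟨hc.desc c, fun j hj ↦ hc.fac c ⟨j, hj⟩, fun l hl ↦ hc.uniq c l (fun j ↦ hl j.1 j.2)⟩

/-! ### Attaching a family of cells -/

section CellAttachment

variable [HasColimitsOfSize.{w, w} C] {S : Type w} {P R : S → C} (p : ∀ s, P s ⟶ R s) {X : C}
  (a : ∀ s, P s ⟶ X)

/-- The object obtained from `X` by attaching, simultaneously, one copy of the cell
`p s : P s ⟶ R s` along `a s : P s ⟶ X` for every `s : S`. -/
noncomputable def attach : C := pushout (Sigma.desc a) (Limits.Sigma.map p)

/-- The inclusion of `X` into the object obtained by attaching cells. -/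
noncomputable def attachBase : X ⟶ attach p a := pushout.inl _ _

/-- The cell with index `s`. -/
noncomputable def attachCell (s : S) : R s ⟶ attach p a := Sigma.ι R s ≫ pushout.inr _ _

lemma comp_attachCell (s : S) : p s ≫ attachCell p a s = a s ≫ attachBase p a := by
  have h := Sigma.ι P s ≫= (pushout.condition (f := Sigma.desc a) (g := Limits.Sigma.map p))
  rw [Sigma.ι_desc_assoc, Sigma.ι_map_assoc] at h
  exact h.symm

variable {p a}

lemma attach_hom_ext {Z : C} {g h : attach p a ⟶ Z}
    (h₁ : attachBase p a ≫ g = attachBase p a ≫ h)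
    (h₂ : ∀ s, attachCell p a s ≫ g = attachCell p a s ≫ h) : g = h :=
  pushout.hom_ext h₁ (Sigma.hom_ext _ _ fun s ↦
    (Category.assoc _ _ _).symm.trans ((h₂ s).trans (Category.assoc _ _ _)))

/-- The morphism out of the object obtained by attaching cells that is induced by a morphism out
of the base and compatible morphisms out of the cells. -/
noncomputable def attachDesc {Z : C} (g : X ⟶ Z) (r : ∀ s, R s ⟶ Z)
    (h : ∀ s, p s ≫ r s = a s ≫ g) : attach p a ⟶ Z :=
  pushout.desc g (Sigma.desc r) (Sigma.hom_ext _ _ fun s ↦ by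
    rw [Sigma.ι_desc_assoc, Sigma.ι_map_assoc, Sigma.ι_desc, h])

@[simp]
lemma attachBase_desc {Z : C} (g : X ⟶ Z) (r : ∀ s, R s ⟶ Z)
    (h : ∀ s, p s ≫ r s = a s ≫ g) : attachBase p a ≫ attachDesc g r h = g :=
  pushout.inl_desc _ _ _

@[simp]
lemma attachCell_desc {Z : C} (g : X ⟶ Z) (r : ∀ s, R s ⟶ Z)
    (h : ∀ s, p s ≫ r s = a s ≫ g) (s : S) : attachCell p a s ≫ attachDesc g r h = r s :=
  (Category.assoc _ _ _).trans ((Sigma.ι R s ≫= pushout.inr_desc _ _ _).trans (Sigma.ι_desc _ _))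

section Filtration

variable (p a) {J : Type w} [LinearOrder J] (e : S → J)

/-- The functor sending `j` to the object obtained from `X` by attaching only the cells whose
index `s` satisfies `e s < j`. -/
noncomputable def attachFiltration : J ⥤ C where
  obj j := attach (fun s : { s // e s < j } ↦ p s) (fun s ↦ a s)
  map {i j} φ := attachDesc (attachBase _ _)
    (fun s ↦ attachCell (fun s : { s // e s < j } ↦ p s) (fun s ↦ a s)
      ⟨s.1, s.2.trans_le (leOfHom φ)⟩)
    (fun s ↦ comp_attachCell (fun s : { s // e s < j } ↦ p s) (fun s ↦ a s)
      ⟨s.1, s.2.trans_le (leOfHom φ)⟩)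
  map_id j := attach_hom_ext (by simp) (by simp)
  map_comp φ ψ := attach_hom_ext (by simp [reassoc_of% @attachBase_desc])
    (by simp [reassoc_of% @attachCell_desc])

/-- The inclusion of `X` in the `j`-th stage of `attachFiltration`. -/
noncomputable def filtrationBase (j : J) : X ⟶ (attachFiltration p a e).obj j :=
  attachBase _ _

/-- The cell with index `s` in the `j`-th stage of `attachFiltration`. -/
noncomputable def filtrationCell (j : J) (s : S) (hs : e s < j) :
    R s ⟶ (attachFiltration p a e).obj j :=
  attachCell (fun s : { s // e s < j } ↦ p s) (fun s ↦ a s) ⟨s, hs⟩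

lemma comp_filtrationCell (j : J) (s : S) (hs : e s < j) :
    p s ≫ filtrationCell p a e j s hs = a s ≫ filtrationBase p a e j :=
  comp_attachCell (fun s : { s // e s < j } ↦ p s) (fun s ↦ a s) ⟨s, hs⟩

@[simp]
lemma filtrationBase_map {i j : J} (φ : i ⟶ j) :
    filtrationBase p a e i ≫ (attachFiltration p a e).map φ = filtrationBase p a e j := by
  dsimp only [filtrationBase, attachFiltration]
  rw [attachBase_desc]

@[simp]
lemma filtrationCell_map {i j : J} (φ : i ⟶ j) (s : S) (hs : e s < i) :
    filtrationCell p a e i s hs ≫ (attachFiltration p a e).map φ =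
      filtrationCell p a e j s (hs.trans_le (leOfHom φ)) := by
  dsimp only [filtrationCell, attachFiltration]
  rw [attachCell_desc]

variable {p a e}

lemma filtration_hom_ext {j : J} {Z : C} {g h : (attachFiltration p a e).obj j ⟶ Z}
    (h₁ : filtrationBase p a e j ≫ g = filtrationBase p a e j ≫ h)
    (h₂ : ∀ s hs, filtrationCell p a e j s hs ≫ g = filtrationCell p a e j s hs ≫ h) : g = h :=
  attach_hom_ext h₁ (fun s ↦ h₂ s.1 s.2)

/-- The morphism out of the `j`-th stage of `attachFiltration` induced by a morphism out of the
base and compatible morphisms out of the cells. -/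
noncomputable def filtrationDesc {j : J} {Z : C} (g : X ⟶ Z) (r : ∀ s, e s < j → (R s ⟶ Z))
    (h : ∀ s hs, p s ≫ r s hs = a s ≫ g) : (attachFiltration p a e).obj j ⟶ Z :=
  attachDesc g (fun s ↦ r s.1 s.2) (fun s ↦ h s.1 s.2)

@[simp]
lemma filtrationBase_desc {j : J} {Z : C} (g : X ⟶ Z) (r : ∀ s, e s < j → (R s ⟶ Z))
    (h : ∀ s hs, p s ≫ r s hs = a s ≫ g) :
    filtrationBase p a e j ≫ filtrationDesc g r h = g :=
  attachBase_desc _ _ _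

@[simp]
lemma filtrationCell_desc {j : J} {Z : C} (g : X ⟶ Z) (r : ∀ s, e s < j → (R s ⟶ Z))
    (h : ∀ s hs, p s ≫ r s hs = a s ≫ g) (s : S) (hs : e s < j) :
    filtrationCell p a e j s hs ≫ filtrationDesc g r h = r s hs :=
  attachCell_desc (p := fun s : { s // e s < j } ↦ p s) (a := fun s ↦ a s) _ _ _ ⟨s, hs⟩

variable [SuccOrder J] [OrderBot J]

instance attachFiltration_isWellOrderContinuous [NoMaxOrder J] :
    (attachFiltration p a e).IsWellOrderContinuous := by
  refine isWellOrderContinuous_of_existsUnique _ (fun m hm Z k hk ↦ ?_)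
  refine ⟨filtrationDesc (filtrationBase p a e _ ≫ k ⊥ hm.bot_lt)
    (fun s hs ↦ filtrationCell p a e (Order.succ (e s)) s (Order.lt_succ _) ≫
      k (Order.succ (e s)) (hm.succ_lt hs)) (fun s hs ↦ ?_), fun j hj ↦ ?_, fun f hf ↦ ?_⟩
  · rw [reassoc_of% @comp_filtrationCell, ← hk ⊥ _ bot_le (hm.succ_lt hs),
      reassoc_of% @filtrationBase_map]
  · refine filtration_hom_ext ?_ (fun s hs ↦ ?_)
    · rw [reassoc_of% @filtrationBase_map, filtrationBase_desc, ← hk ⊥ _ bot_le hj,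
        reassoc_of% @filtrationBase_map]
    · rw [reassoc_of% @filtrationCell_map, filtrationCell_desc,
        ← hk _ _ (Order.succ_le_of_lt hs) hj,
        reassoc_of% @filtrationCell_map]
  · refine filtration_hom_ext ?_ (fun s hs ↦ ?_)
    · rw [filtrationBase_desc, ← hf ⊥ hm.bot_lt, reassoc_of% @filtrationBase_map]
    · rw [filtrationCell_desc, ← hf _ (hm.succ_lt hs), reassoc_of% @filtrationCell_map]

variable (p a e) in
/-- The cocone with point `attach p a` over `attachFiltration p a e`. -/
noncomputable def filtrationIncl :
    attachFiltration p a e ⟶ (Functor.const _).obj (attach p a) where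
  app j := filtrationDesc (attachBase p a) (fun s _ ↦ attachCell p a s)
    (fun s _ ↦ comp_attachCell p a s)
  naturality i j φ := filtration_hom_ext (by simp [reassoc_of% @filtrationBase_map])
    (by simp [reassoc_of% @filtrationCell_map])

variable (p a e) in
/-- The object `attach p a` is the colimit of the stages of `attachFiltration p a e`. -/
noncomputable def isColimitFiltrationIncl [NoMaxOrder J] :
    IsColimit (Cocone.mk _ (filtrationIncl p a e)) where
  desc c := attachDesc (filtrationBase p a e _ ≫ c.ι.app ⊥)
    (fun s ↦ filtrationCell p a e (Order.succ (e s)) s (Order.lt_succ _) ≫ c.ι.app _)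
    (fun s ↦ by
      rw [reassoc_of% @comp_filtrationCell, ← c.w (homOfLE bot_le : ⊥ ⟶ Order.succ (e s)),
        reassoc_of% @filtrationBase_map])
  fac c j := by
    refine filtration_hom_ext ?_ (fun s hs ↦ ?_)
    · simp only [filtrationIncl, reassoc_of% @filtrationBase_desc, attachBase_desc]
      rw [← c.w (homOfLE bot_le : ⊥ ⟶ j), reassoc_of% @filtrationBase_map]
    · simp only [filtrationIncl, reassoc_of% @filtrationCell_desc, attachCell_desc]
      rw [← c.w (homOfLE (Order.succ_le_of_lt hs)), reassoc_of% @filtrationCell_map]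
  uniq c f hf := by
    refine attach_hom_ext ?_ (fun s ↦ ?_)
    · rw [attachBase_desc, ← hf]
      simp [filtrationIncl, reassoc_of% @filtrationBase_desc]
    · rw [attachCell_desc, ← hf]
      simp [filtrationIncl, reassoc_of% @filtrationCell_desc]

end Filtration

end CellAttachment

/-- A commutative square is a pushout as soon as compatible pairs of morphisms factor uniquely. -/
lemma isPushout_of_existsUnique {A B B' D : C} {f : A ⟶ B} {g : A ⟶ B'} {h : B ⟶ D} {k : B' ⟶ D}
    (w : f ≫ h = g ≫ k)
    (H : ∀ (Z : C) (b : B ⟶ Z) (b' : B' ⟶ Z), f ≫ b = g ≫ b' →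
      ∃! l : D ⟶ Z, h ≫ l = b ∧ k ≫ l = b') : IsPushout f g h k :=
  ⟨⟨w⟩, ⟨PushoutCocone.IsColimit.mk w
    (fun s ↦ (H _ _ _ s.condition).choose)
    (fun s ↦ (H _ _ _ s.condition).choose_spec.1.1)
    (fun s ↦ (H _ _ _ s.condition).choose_spec.1.2)
    (fun s m h₁ h₂ ↦ (H _ _ _ s.condition).choose_spec.2 m ⟨h₁, h₂⟩)⟩⟩

section

variable [HasColimitsOfSize.{w, w} C] {S : Type w} {P R : S → C} (p : ∀ s, P s ⟶ R s) {X : C}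
  (a : ∀ s, P s ⟶ X) {J : Type w} [LinearOrder J] [SuccOrder J] [NoMaxOrder J]

lemma isPushout_filtrationCell {e : S → J} (he : Function.Injective e) (s : S) :
    IsPushout (a s ≫ filtrationBase p a e (e s)) (p s)
      ((attachFiltration p a e).map (homOfLE (Order.le_succ (e s))))
      (filtrationCell p a e (Order.succ (e s)) s (Order.lt_succ _)) := by
  refine isPushout_of_existsUnique (by
      rw [Category.assoc, filtrationBase_map, comp_filtrationCell]) (fun Z b b' hb ↦ ?_)
  have hs (t : S) (ht : e t < Order.succ (e s)) (h : ¬ e t < e s) : s = t :=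
    he (le_antisymm (not_lt.1 h) (Order.lt_succ_iff.1 ht))
  classical
  refine ⟨filtrationDesc (filtrationBase p a e _ ≫ b)
    (fun t ht ↦ if h : e t < e s then filtrationCell p a e _ t h ≫ b else
      eqToHom (by rw [hs t ht h]) ≫ b') (fun t ht ↦ ?_), ⟨?_, ?_⟩, ?_⟩
  · split_ifs with h
    · rw [reassoc_of% @comp_filtrationCell]
    · obtain rfl := hs t ht h
      simpa using hb.symm
  · refine filtration_hom_ext (by simp [reassoc_of% @filtrationBase_map]) (fun t ht ↦ ?_)
    rw [reassoc_of% @filtrationCell_map, filtrationCell_desc, dif_pos ht]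
  · rw [filtrationCell_desc, dif_neg (lt_irrefl _)]
    simp
  · rintro l ⟨h₁, h₂⟩
    refine filtration_hom_ext (by rw [filtrationBase_desc, ← h₁, reassoc_of% @filtrationBase_map])
      (fun t ht ↦ ?_)
    rw [filtrationCell_desc]
    split_ifs with h
    · rw [← h₁, reassoc_of% @filtrationCell_map]
    · obtain rfl := hs t ht h
      simp [← h₂]

lemma isIso_attachFiltration_map {e : S → J} {j : J} (hj : ∀ s, e s ≠ j) :
    IsIso ((attachFiltration p a e).map (homOfLE (Order.le_succ j))) := by
  have h (s : S) (hs : e s < Order.succ j) : e s < j :=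
    lt_of_le_of_ne (Order.lt_succ_iff.1 hs) (hj s)
  refine ⟨filtrationDesc (filtrationBase p a e j) (fun s hs ↦ filtrationCell p a e j s (h s hs))
    (fun s hs ↦ comp_filtrationCell p a e j s _), ?_, ?_⟩
  · exact filtration_hom_ext (by simp [reassoc_of% @filtrationBase_map])
      (by simp [reassoc_of% @filtrationCell_map])
  · exact filtration_hom_ext (by simp [reassoc_of% @filtrationBase_desc])
      (by simp [reassoc_of% @filtrationCell_desc])

/-- Attaching a family of cells is a transfinite composition of morphisms that each attach at most
one cell. Here `e` is any injection of the index set into a well-ordered type without maximum. -/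
lemma transfiniteCompositionsOfShape_attachBase [OrderBot J] [WellFoundedLT J] {e : S → J}
    (he : Function.Injective e) {W : MorphismProperty C}
    (hiso : ∀ ⦃Z Z' : C⦄ (n : Z ⟶ Z') [IsIso n], W n)
    (hW : ∀ (s : S) ⦃Z Z' : C⦄ (g : X ⟶ Z) (n : Z ⟶ Z') (r : R s ⟶ Z'),
      IsPushout (a s ≫ g) (p s) n r → W n) :
    W.transfiniteCompositionsOfShape J (attachBase p a) :=
  ⟨{ F := attachFiltration p a e
     isoBot :=
      { hom := filtrationDesc (𝟙 X) (fun s hs ↦ (not_lt_bot hs).elim)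
          (fun s hs ↦ (not_lt_bot hs).elim)
        inv := filtrationBase p a e ⊥
        hom_inv_id := filtration_hom_ext (by simp [reassoc_of% @filtrationBase_desc]) (fun s hs ↦ (not_lt_bot hs).elim)
        inv_hom_id := by simp }
     incl := filtrationIncl p a e
     isColimit := isColimitFiltrationIncl p a e
     fac := by simp [filtrationIncl]
     map_mem := fun j hj ↦ by
      by_cases h : ∃ s, e s = j
      · obtain ⟨s, rfl⟩ := h
        exact hW s _ _ _ (isPushout_filtrationCell p a he s)
      · have := isIso_attachFiltration_map p a (e := e) (not_exists.1 h)
        exact hiso _ }⟩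

end

/-! ### Iterated transfinite compositions -/

section LexComposition

variable {J J₀ : Type w} [LinearOrder J] [SuccOrder J] [OrderBot J] [WellFoundedLT J]
  [LinearOrder J₀] [SuccOrder J₀] [OrderBot J₀] [WellFoundedLT J₀]
  {X Y : C} {f : X ⟶ Y} (c : TransfiniteCompositionOfShape J f)
  {W : MorphismProperty C}
  (d : ∀ j, W.TransfiniteCompositionOfShape J₀ (c.F.map (homOfLE (Order.le_succ j))))

/-- The inclusion of the `j`-th stage of the outer chain in the stage `a` of the `j`-th inner
chain. -/
def lexBase (j : J) (a : J₀) : c.F.obj j ⟶ (d j).F.obj a :=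
  (d j).isoBot.inv ≫ (d j).F.map (homOfLE bot_le)

/-- The morphism from the stage `a` of the `j`-th inner chain to the stage `Order.succ j` of the
outer chain. -/
def lexTop (j : J) (a : J₀) : (d j).F.obj a ⟶ c.F.obj (Order.succ j) :=
  (d j).incl.app a

@[simp]
lemma lexBase_map (j : J) {a b : J₀} (h : a ⟶ b) :
    lexBase c d j a ≫ (d j).F.map h = lexBase c d j b := by
  simp only [lexBase, Category.assoc, ← Functor.map_comp]
  rfl

@[simp]
lemma map_lexTop (j : J) {a b : J₀} (h : a ⟶ b) :
    (d j).F.map h ≫ lexTop c d j b = lexTop c d j a :=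
  ((d j).incl.naturality h).trans (Category.comp_id _)

@[simp]
lemma lexBase_lexTop (j : J) (a : J₀) :
    lexBase c d j a ≫ lexTop c d j a = c.F.map (homOfLE (Order.le_succ j)) := by
  rw [lexBase, Category.assoc, map_lexTop]
  exact (d j).fac

lemma lexObj_eq {i j : J} (h : i = j) (a : J₀) : (d i).F.obj a = (d j).F.obj a := by
  subst h; rfl

/-- The transition morphisms between the stages of the inner chains, ordered lexicographically. -/
def lexMap {i j : J} {a b : J₀} (h : i < j ∨ i = j ∧ a ≤ b) : (d i).F.obj a ⟶ (d j).F.obj b :=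
  if h' : i < j then
    lexTop c d i a ≫ c.F.map (homOfLE (Order.succ_le_of_lt h')) ≫ lexBase c d j b
  else eqToHom (lexObj_eq c d (h.resolve_left h').1 a) ≫
    (d j).F.map (homOfLE (h.resolve_left h').2)

lemma lexMap_of_lt {i j : J} {a b : J₀} (h : i < j ∨ i = j ∧ a ≤ b) (h' : i < j) :
    lexMap c d h =
      lexTop c d i a ≫ c.F.map (homOfLE (Order.succ_le_of_lt h')) ≫ lexBase c d j b :=
  dif_pos h'

lemma lexMap_self {i : J} {a b : J₀} (h : i < i ∨ i = i ∧ a ≤ b) (h' : a ≤ b) :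
    lexMap c d h = (d i).F.map (homOfLE h') := by
  rw [lexMap, dif_neg (lt_irrefl i)]
  simp

lemma lexMap_comp {i j k : J} {a b e : J₀} (h : i < j ∨ i = j ∧ a ≤ b)
    (h' : j < k ∨ j = k ∧ b ≤ e) (h'' : i < k ∨ i = k ∧ a ≤ e) :
    lexMap c d h ≫ lexMap c d h' = lexMap c d h'' := by
  obtain hij | ⟨rfl, hab⟩ := h <;> obtain hjk | ⟨rfl, hbe⟩ := h'
  · rw [lexMap_of_lt c d _ hij, lexMap_of_lt c d _ hjk, lexMap_of_lt c d _ (hij.trans hjk)]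
    simp only [Category.assoc, reassoc_of% @lexBase_lexTop, ← Functor.map_comp_assoc]
    rfl
  · rw [lexMap_of_lt c d _ hij, lexMap_self c d _ hbe, lexMap_of_lt c d _ hij]
    simp
  · rw [lexMap_self c d _ hab, lexMap_of_lt c d _ hjk, lexMap_of_lt c d _ hjk]
    simp [reassoc_of% @map_lexTop]
  · rw [lexMap_self c d _ hab, lexMap_self c d _ hbe, lexMap_self c d _ (hab.trans hbe),
      ← Functor.map_comp]
    rfl

/-- The concatenation of the inner chains, indexed by the lexicographic product. -/
def lexFunctor : J ×ₗ J₀ ⥤ C where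
  obj x := (d (ofLex x).1).F.obj (ofLex x).2
  map φ := lexMap c d (Prod.Lex.le_iff.1 (leOfHom φ))
  map_id x := by
    rw [lexMap_self c d _ le_rfl]
    exact (d _).F.map_id _
  map_comp φ ψ := (lexMap_comp c d _ _ _).symm

/-- If an object `L` is a colimit of the stages of the outer chain whose index satisfies `D`, it
is also a colimit of the corresponding inner stages. -/
lemma lex_existsUnique {L : C} {D : J → Prop} (hD : ∀ i, D i → D (Order.succ i))
    [NoMaxOrder J] (t : ∀ i, D i → (c.F.obj i ⟶ L))
    (ht : ∀ i j (hij : i ≤ j) (hi : D i) (hj : D j), c.F.map (homOfLE hij) ≫ t j hj = t i hi)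
    {Z : C} (hU : ∀ (k : ∀ i, D i → (c.F.obj i ⟶ Z)),
      (∀ i j (hij : i ≤ j) (hi : D i) (hj : D j), c.F.map (homOfLE hij) ≫ k j hj = k i hi) →
      ∃! l : L ⟶ Z, ∀ i hi, t i hi ≫ l = k i hi)
    (k : ∀ i, D i → ∀ a, (d i).F.obj a ⟶ Z)
    (hk : ∀ i j (hi : D i) (hj : D j) a b (h : i < j ∨ i = j ∧ a ≤ b),
      lexMap c d h ≫ k j hj b = k i hi a) :
    ∃! l : L ⟶ Z, ∀ i hi a, lexTop c d i a ≫ t (Order.succ i) (hD i hi) ≫ l = k i hi a := by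
  obtain ⟨l, hl, hl'⟩ := hU (fun i hi ↦ lexBase c d i ⊥ ≫ k i hi ⊥) (by
    intro i j hij hi hj
    obtain h | rfl := hij.lt_or_eq
    · rw [← hk i j hi hj ⊥ ⊥ (.inl h), lexMap_of_lt c d _ h]
      simp only [Category.assoc, reassoc_of% @lexBase_lexTop, ← Functor.map_comp_assoc]
      rfl
    · exact (congr_arg (· ≫ _) (c.F.map_id _)).trans (Category.id_comp _))
  refine ⟨l, fun i hi a ↦ ?_, fun l' h ↦ hl' l' (fun i hi ↦ ?_)⟩
  · rw [hl, ← hk i _ hi (hD i hi) a ⊥ (.inl (Order.lt_succ i)),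
      lexMap_of_lt c d _ (Order.lt_succ i), Category.assoc, Category.assoc]
    congr 1
    exact ((congr_arg (· ≫ _) (c.F.map_id _)).trans (Category.id_comp _)).symm
  · rw [← h, reassoc_of% @lexBase_lexTop, ← ht i _ (Order.le_succ i) hi (hD i hi), Category.assoc]

lemma lex_existsUnique_of_isSuccLimit [NoMaxOrder J] {j : J} (hj : Order.IsSuccLimit j) {Z : C}
    (k : ∀ i, i < j → ∀ a, (d i).F.obj a ⟶ Z)
    (hk : ∀ i j hi hj a b (h : i < j ∨ i = j ∧ a ≤ b), lexMap c d h ≫ k j hj b = k i hi a) :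
    ∃! l : c.F.obj j ⟶ Z, ∀ i (hi : i < j) a,
      lexTop c d i a ≫ c.F.map (homOfLE (Order.succ_le_of_lt hi)) ≫ l = k i hi a :=
  lex_existsUnique c d (D := fun i ↦ i < j) (fun _ hi ↦ hj.succ_lt hi)
    (fun i hi ↦ c.F.map (homOfLE hi.le))
    (fun i j hij hi hj ↦ by rw [← Functor.map_comp]; rfl)
    (fun k hk ↦ existsUnique_of_isWellOrderContinuous c.F j hj Z k
      (fun i j hij hj ↦ hk i j hij _ hj)) k hk

lemma lex_existsUnique_of_eq_succ {j : J} {Z : C} [NoMaxOrder J]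
    (k : ∀ i, i < Order.succ j → ∀ a, (d i).F.obj a ⟶ Z)
    (hk : ∀ i j hi hj a b (h : i < j ∨ i = j ∧ a ≤ b), lexMap c d h ≫ k j hj b = k i hi a) :
    ∃! l : c.F.obj (Order.succ j) ⟶ Z, ∀ i (hi : i < Order.succ j) a,
      lexTop c d i a ≫ c.F.map (homOfLE (Order.succ_le_of_lt hi)) ≫ l = k i hi a := by
  let s : Cocone (d j).F :=
    { pt := Z
      ι :=
        { app a := k j (Order.lt_succ j) a
          naturality a b φ := by
            rw [← hk j j (Order.lt_succ j) (Order.lt_succ j) a b (.inr ⟨rfl, leOfHom φ⟩),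
              lexMap_self c d _ (leOfHom φ)]
            exact (Category.comp_id _).symm } }
  have hid (g : c.F.obj (Order.succ j) ⟶ Z) (h : Order.succ j ≤ Order.succ j) :
      c.F.map (homOfLE h) ≫ g = g :=
    (congr_arg (· ≫ _) (c.F.map_id _)).trans (Category.id_comp _)
  have hs (a : J₀) : lexTop c d j a ≫ (d j).isColimit.desc s = k j (Order.lt_succ j) a :=
    (d j).isColimit.fac s a
  refine ⟨(d j).isColimit.desc s, fun i hi a ↦ ?_, fun l hl ↦ (d j).isColimit.uniq s l (fun a ↦ ?_)⟩
  · obtain h | rfl := (Order.lt_succ_iff.1 hi).lt_or_eq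
    · rw [← hk i j hi (Order.lt_succ j) a ⊥ (.inl h), lexMap_of_lt c d _ h, ← hs]
      simp only [Category.assoc, reassoc_of% @lexBase_lexTop, ← Functor.map_comp_assoc]
      rfl
    · rw [hid]
      exact hs a
  · exact (congr_arg (lexTop c d j a ≫ ·) (hid l le_rfl)).symm.trans (hl j (Order.lt_succ j) a)

lemma lexBase_bot_isIso (j : J) : IsIso (lexBase c d j ⊥) := by
  have h : (d j).F.map (homOfLE (bot_le : (⊥ : J₀) ≤ ⊥)) = 𝟙 _ := (d j).F.map_id _
  rw [lexBase, h]
  infer_instance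

lemma lexFunctor_isWellOrderContinuous [NoMaxOrder J] :
    (lexFunctor c d).IsWellOrderContinuous := by
  refine isWellOrderContinuous_of_existsUnique _ (fun m hm Z k hk ↦ ?_)
  obtain ⟨j, b, rfl⟩ : ∃ (j : J) (b : J₀), m = toLex (j, b) := ⟨(ofLex m).1, (ofLex m).2, rfl⟩
  let k' (i : J) (a : J₀) (h : i < j ∨ i = j ∧ a < b) : (d i).F.obj a ⟶ Z :=
    k (toLex (i, a)) (Prod.Lex.toLex_lt_toLex.2 h)
  have hk' (i i' : J) (a a' : J₀) (hi) (hi') (h : i < i' ∨ i = i' ∧ a ≤ a') :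
      lexMap c d h ≫ k' i' a' hi' = k' i a hi :=
    hk (toLex (i, a)) (toLex (i', a')) (Prod.Lex.toLex_le_toLex.2 h) _
  suffices ∃! l : (d j).F.obj b ⟶ Z, ∀ i a (h : i < j ∨ i = j ∧ a < b),
      lexMap c d (h.imp_right (And.imp_right le_of_lt)) ≫ l = k' i a h by
    obtain ⟨l, hl, hl'⟩ := this
    exact ⟨l, fun x hx ↦ hl (ofLex x).1 (ofLex x).2 (Prod.Lex.lt_iff.1 hx),
      fun g hg ↦ hl' g (fun i a h ↦ hg (toLex (i, a)) (Prod.Lex.toLex_lt_toLex.2 h))⟩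
  by_cases hb : b = ⊥
  · subst hb
    suffices ∃! l : c.F.obj j ⟶ Z, ∀ i (hi : i < j) a,
        lexTop c d i a ≫ c.F.map (homOfLE (Order.succ_le_of_lt hi)) ≫ l = k' i a (.inl hi) by
      obtain ⟨l, hl, hl'⟩ := this
      have := lexBase_bot_isIso c d j
      refine ⟨inv (lexBase c d j ⊥) ≫ l, fun i a h ↦ ?_, fun g hg ↦ ?_⟩
      · have h' := h.resolve_right (fun h ↦ not_lt_bot h.2)
        rw [lexMap_of_lt c d _ h']
        simp [hl i h']
      · rw [IsIso.eq_inv_comp]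
        refine hl' _ (fun i hi a ↦ ?_)
        rw [← hg i a (.inl hi), lexMap_of_lt c d _ hi]
        simp
    have hmin : ¬ IsMin j := fun h ↦ by
      obtain rfl := h.eq_bot
      exact hm.not_isMin isMin_bot
    by_cases hj : Order.IsSuccPrelimit j
    · exact lex_existsUnique_of_isSuccLimit c d ⟨hmin, hj⟩ _
        (fun i i' hi hi' a a' ↦ hk' i i' a a' (.inl hi) (.inl hi'))
    · obtain ⟨i, hi⟩ := not_forall_not.1 hj
      obtain rfl := hi.succ_eq
      exact lex_existsUnique_of_eq_succ c d _
        (fun i i' hi hi' a a' ↦ hk' i i' a a' (.inl hi) (.inl hi'))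
  · have hb' : Order.IsSuccLimit b := by
      refine ⟨fun h ↦ hb h.eq_bot, fun a ha ↦ hm.2 (toLex (j, a)) ?_⟩
      exact Prod.Lex.toLex_covBy_toLex_iff.2 (.inl ⟨rfl, ha⟩)
    obtain ⟨l, hl, hl'⟩ := existsUnique_of_isWellOrderContinuous (d j).F b hb' Z
      (fun a ha ↦ k' j a (.inr ⟨rfl, ha⟩)) (fun a a' haa' ha' ↦ by
        rw [← hk' j j a a' (.inr ⟨rfl, haa'.trans_lt ha'⟩) (.inr ⟨rfl, ha'⟩) (.inr ⟨rfl, haa'⟩),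
          lexMap_self c d _ haa'])
    refine ⟨l, fun i a h ↦ ?_, fun g hg ↦ hl' g (fun a ha ↦ ?_)⟩
    · obtain h | ⟨rfl, ha⟩ := h
      · rw [← hk' i j a ⊥ (.inl h) (.inr ⟨rfl, hb'.bot_lt⟩) (.inl h), ← hl ⊥ hb'.bot_lt,
          ← lexMap_self c d (.inr ⟨rfl, bot_le⟩) bot_le, ← Category.assoc, lexMap_comp]
      · rw [lexMap_self c d _ ha.le, hl a ha]
    · rw [← hg j a (.inr ⟨rfl, ha⟩), lexMap_self c d _ ha.le]

/-- The successor structure on a lexicographic product whose second factor has no maximum: the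
successor of `(i, a)` is `(i, Order.succ a)`. -/
abbrev lexSuccOrder (J J₀ : Type w) [LinearOrder J] [LinearOrder J₀] [SuccOrder J₀]
    [NoMaxOrder J₀] : SuccOrder (J ×ₗ J₀) :=
  SuccOrder.ofSuccLeIff (fun x ↦ toLex ((ofLex x).1, Order.succ (ofLex x).2)) (fun {x y} ↦ by
    rw [Prod.Lex.le_iff, Prod.Lex.lt_iff]
    simp)

@[simp]
lemma lexMap_lexTop_incl [NoMaxOrder J] {i j : J} {a b : J₀} (h : i < j ∨ i = j ∧ a ≤ b) :
    lexMap c d h ≫ lexTop c d j b ≫ c.incl.app (Order.succ j) =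
      lexTop c d i a ≫ c.incl.app (Order.succ i) := by
  obtain h | ⟨rfl, hab⟩ := h
  · rw [lexMap_of_lt c d _ h, Category.assoc, Category.assoc, reassoc_of% @lexBase_lexTop,
      ← Functor.map_comp_assoc]
    congr 1
    exact (c.incl.naturality _).trans (Category.comp_id _)
  · rw [lexMap_self c d _ hab, reassoc_of% @map_lexTop]

include c d in
/-- A transfinite composition of transfinite compositions is a transfinite composition. -/
lemma transfiniteCompositions_of_lex [NoMaxOrder J] [NoMaxOrder J₀] :
    MorphismProperty.transfiniteCompositions.{w} W f := by
  let _ := lexSuccOrder J J₀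
  have hU {Z : C} := lex_existsUnique c d (D := fun _ ↦ True) (fun _ _ ↦ trivial)
    (fun i _ ↦ c.incl.app i) (fun i j hij _ _ ↦ (c.incl.naturality _).trans (Category.comp_id _))
    (Z := Z) (fun k hk ↦ by
      let s : Cocone c.F :=
        { pt := Z
          ι :=
            { app i := k i trivial
              naturality i j φ :=
                (hk i j (leOfHom φ) trivial trivial).trans (Category.comp_id _).symm } }
      exact ⟨c.isColimit.desc s, fun i _ ↦ c.isColimit.fac s i,
        fun l hl ↦ c.isColimit.uniq s l (fun i ↦ hl i trivial)⟩)
  refine MorphismProperty.transfiniteCompositionsOfShape_le_transfiniteCompositions W (J ×ₗ J₀) _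
    ⟨{ F := lexFunctor c d
       isoBot := (d ⊥).isoBot ≪≫ c.isoBot
       isWellOrderContinuous := lexFunctor_isWellOrderContinuous c d
       incl :=
        { app x := lexTop c d (ofLex x).1 (ofLex x).2 ≫ c.incl.app _
          naturality x y φ := (lexMap_lexTop_incl c d
            (Prod.Lex.le_iff.1 (leOfHom φ))).trans (Category.comp_id _).symm }
       isColimit := ?_
       fac := ?_
       map_mem := fun x _ ↦ ?_ }⟩
  · have h (s : Cocone (lexFunctor c d)) := hU (fun i _ a ↦ s.ι.app (toLex (i, a)))
      (fun i j _ _ a b h ↦ s.w (homOfLE (Prod.Lex.toLex_le_toLex.2 h : toLex (i, a) ≤ toLex (j, b))))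
    exact
      { desc s := (h s).choose
        fac s x := (Category.assoc _ _ _).trans
          ((h s).choose_spec.1 (ofLex x).1 trivial (ofLex x).2)
        uniq s l hl := (h s).choose_spec.2 l (fun i _ a ↦
          (Category.assoc _ _ _).symm.trans (hl (toLex (i, a)))) }
  · change ((d ⊥).isoBot ≪≫ c.isoBot).inv ≫ lexTop c d ⊥ ⊥ ≫ c.incl.app (Order.succ ⊥) = f
    have h : (d ⊥).isoBot.inv ≫ lexTop c d ⊥ ⊥ = c.F.map (homOfLE (Order.le_succ ⊥)) :=
      (d ⊥).fac
    rw [Iso.trans_inv, Category.assoc, reassoc_of% h]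
    refine (c.isoBot.inv ≫= ?_).trans c.fac
    exact (c.incl.naturality _).trans (Category.comp_id _)
  · obtain ⟨i, a, rfl⟩ : ∃ (i : J) (a : J₀), x = toLex (i, a) := ⟨_, _, rfl⟩
    change W (lexMap c d (i := i) (j := i) (a := a) (b := Order.succ a)
      (.inr ⟨rfl, Order.le_succ a⟩))
    rw [lexMap_self c d (.inr ⟨rfl, Order.le_succ a⟩) (Order.le_succ a)]
    exact (d i).map_mem a (not_isMax a)

end LexComposition

/-! ### Presentable morphisms -/

/-- A pushout of a morphism between `α`-presentable objects is an `α`-presentable morphism. -/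
lemma presentableMorphisms_of_isPushout {α : Cardinal.{w}} [Fact α.IsRegular] {P R X B : C}
    {a : P ⟶ X} {p : P ⟶ R} {n : X ⟶ B} {r : R ⟶ B} (h : IsPushout a p n r)
    [IsCardinalPresentable P α] [IsCardinalPresentable R α] : presentableMorphisms C α n where
  preservesColimitOfShape J _ _ := ⟨fun {F} ↦ ⟨fun {c} hc ↦ ⟨by
    have := isFiltered_of_isCardinalFiltered J α
    have hc' := isColimitOfPreserves (Under.forget X) hc
    let γ (j : J) : F.obj j ⟶ c.pt := c.ι.app j
    have hγ {j k : J} (u : j ⟶ k) : F.map u ≫ γ k = γ j := c.w u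
    have h₁ {A : C} [IsCardinalPresentable A α] (f : A ⟶ c.pt.right) :
        ∃ (j : J) (g : A ⟶ (F.obj j).right), g ≫ (γ j).right = f :=
      IsCardinalPresentable.exists_hom_of_isColimit α hc' f
    have h₂ {A : C} [IsCardinalPresentable A α] {j : J} (f g : A ⟶ (F.obj j).right)
        (hfg : f ≫ (γ j).right = g ≫ (γ j).right) :
        ∃ (k : J) (u : j ⟶ k), f ≫ (F.map u).right = g ≫ (F.map u).right :=
      IsCardinalPresentable.exists_eq_of_isColimit' α hc' (i := j) f g hfg
    have h₃ (x : Under.mk n ⟶ c.pt) : ∃ (j : J) (y : Under.mk n ⟶ F.obj j), x = y ≫ γ j := by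
      obtain ⟨j, y, hy⟩ := h₁ (r ≫ x.right)
      have hx : n ≫ x.right = c.pt.hom := Under.w x
      obtain ⟨k, u, hu⟩ := h₂ (a ≫ (F.obj j).hom) (p ≫ y) (by
        rw [Category.assoc, Category.assoc, hy, ← h.w_assoc, hx, Under.w])
      rw [Category.assoc, Category.assoc, Under.w] at hu
      refine ⟨k, Under.homMk (h.desc _ _ hu) (h.inl_desc _ _ _), ?_⟩
      apply Under.UnderMorphism.ext
      change x.right = h.desc _ _ hu ≫ (γ k).right
      refine h.hom_ext ?_ ?_
      · rw [h.inl_desc_assoc, Under.w]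
        exact hx
      · rw [h.inr_desc_assoc, Category.assoc, ← Under.comp_right, hγ, hy]
    have h₄ {j : J} (x y : Under.mk n ⟶ F.obj j) (hxy : x ≫ γ j = y ≫ γ j) :
        ∃ (k : J) (u : j ⟶ k), x ≫ F.map u = y ≫ F.map u := by
      obtain ⟨k, u, hu⟩ := h₂ (r ≫ x.right) (r ≫ y.right) (by
        rw [Category.assoc, Category.assoc, ← Under.comp_right, ← Under.comp_right, hxy])
      refine ⟨k, u, ?_⟩
      apply Under.UnderMorphism.ext
      refine h.hom_ext ?_ ?_
      · exact (Under.w (x ≫ F.map u)).trans (Under.w (y ≫ F.map u)).symm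
      · rwa [Category.assoc, Category.assoc] at hu
    exact Types.FilteredColimit.isColimitOf' _ _ h₃ (fun j x y hxy ↦ h₄ x y hxy)⟩⟩⟩

section ArrowPresentation

/-- Morphisms out of an identity in the category of arrows are the morphisms into the source. -/
def arrowIdAdjunction :
    ({ obj := fun G ↦ Arrow.mk (𝟙 G), map := fun φ ↦ Arrow.homMk φ φ (by simp) } : C ⥤ Arrow C) ⊣
      Arrow.leftFunc :=
  Adjunction.mkOfHomEquiv
    { homEquiv := fun G f ↦
        { toFun := fun g ↦ g.left
          invFun := fun g ↦ Arrow.homMk g (g ≫ f.hom) (Category.id_comp _).symm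
          left_inv := fun g ↦ by
            ext
            · rfl
            · exact (Arrow.w g).trans (Category.id_comp _)
          right_inv := fun g ↦ rfl }
      homEquiv_naturality_left_symm := fun φ g ↦ by
        ext
        · rfl
        · exact Category.assoc _ _ _
      homEquiv_naturality_right := fun _ _ ↦ rfl }

/-- Morphisms out of `⊥_ C ⟶ G` in the category of arrows are the morphisms from `G` into the
target. -/
noncomputable def arrowInitialAdjunction [HasInitial C] :
    ({ obj := fun G ↦ Arrow.mk (initial.to G), map := fun φ ↦ Arrow.homMk (𝟙 _) φ (by simp) } :
      C ⥤ Arrow C) ⊣ Arrow.rightFunc :=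
  Adjunction.mkOfHomEquiv
    { homEquiv := fun G f ↦
        { toFun := fun g ↦ g.right
          invFun := fun g ↦ Arrow.homMk (initial.to _) g (initial.hom_ext _ _)
          left_inv := fun g ↦ by
            ext
            · exact initial.hom_ext _ _
            · rfl
          right_inv := fun g ↦ rfl }
      homEquiv_naturality_left_symm := fun φ g ↦ by
        ext
        · exact initial.hom_ext _ _
        · rfl
      homEquiv_naturality_right := fun _ _ ↦ rfl }

variable (α : Cardinal.{w}) [Fact α.IsRegular]

section

variable [HasColimitsOfSize.{w, w} C]

lemma isCardinalPresentable_arrow_id (G : C) [IsCardinalPresentable G α] :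
    IsCardinalPresentable (Arrow.mk (𝟙 G)) α := by
  have : (Arrow.leftFunc : Arrow C ⥤ C).IsCardinalAccessible α := ⟨fun J _ _ ↦ inferInstance⟩
  exact arrowIdAdjunction.isCardinalPresentable_leftAdjoint_obj α G

lemma isCardinalPresentable_arrow_initial (G : C) [IsCardinalPresentable G α] :
    IsCardinalPresentable (Arrow.mk (initial.to G)) α := by
  have : (Arrow.rightFunc : Arrow C ⥤ C).IsCardinalAccessible α := ⟨fun J _ _ ↦ inferInstance⟩
  exact arrowInitialAdjunction.isCardinalPresentable_leftAdjoint_obj α G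

/-- The arrows `𝟙 G` and `⊥_ C ⟶ G`, where `G` runs through the objects satisfying `P`. -/
def arrowGenerators (P : ObjectProperty C) : ObjectProperty (Arrow C) :=
  ObjectProperty.ofObj (fun G : Subtype P ↦ Arrow.mk (𝟙 G.1)) ⊔
    ObjectProperty.ofObj (fun G : Subtype P ↦ Arrow.mk (initial.to G.1))

lemma isStrongGenerator_arrowGenerators {P : ObjectProperty C} (hP : P.IsStrongGenerator) :
    (arrowGenerators P).IsStrongGenerator := by
  have h₁ (G : C) (hG : P G) : arrowGenerators P (Arrow.mk (𝟙 G)) :=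
    .inl (ObjectProperty.ofObj_apply (fun G : Subtype P ↦ Arrow.mk (𝟙 G.1)) ⟨G, hG⟩)
  have h₂ (G : C) (hG : P G) : arrowGenerators P (Arrow.mk (initial.to G)) :=
    .inr (ObjectProperty.ofObj_apply (fun G : Subtype P ↦ Arrow.mk (initial.to G.1)) ⟨G, hG⟩)
  rw [ObjectProperty.isStrongGenerator_iff]
  refine ⟨fun f g φ ψ h ↦ ?_, fun f g i hi H ↦ ?_⟩
  · ext
    · refine hP.isSeparating _ _ (fun G hG x ↦ ?_)
      exact congr_arg CommaMorphism.left
        (h _ (h₁ G hG) (Arrow.homMk x (x ≫ f.hom) (by simp)))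
    · refine hP.isSeparating _ _ (fun G hG x ↦ ?_)
      exact congr_arg CommaMorphism.right
        (h _ (h₂ G hG) (Arrow.homMk (initial.to _) x (initial.hom_ext _ _)))
  · have hl : IsIso i.left := by
      have : Mono i.left := by
        have := Functor.preservesMonomorphisms_of_adjunction (arrowIdAdjunction (C := C))
        exact inferInstanceAs (Mono (Arrow.leftFunc.map i))
      refine hP.isIso_of_mono _ (fun G hG x ↦ ?_)
      obtain ⟨y, hy⟩ := H _ (h₁ G hG) (Arrow.homMk x (x ≫ g.hom) (by simp))
      exact ⟨y.left, congr_arg CommaMorphism.left hy⟩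
    have hr : IsIso i.right := by
      have : Mono i.right := by
        have := Functor.preservesMonomorphisms_of_adjunction (arrowInitialAdjunction (C := C))
        exact inferInstanceAs (Mono (Arrow.rightFunc.map i))
      refine hP.isIso_of_mono _ (fun G hG x ↦ ?_)
      obtain ⟨y, hy⟩ := H _ (h₂ G hG) (Arrow.homMk (initial.to _) x (initial.hom_ext _ _))
      exact ⟨y.right, congr_arg CommaMorphism.right hy⟩
    exact Arrow.isIso_of_isIso_left_of_isIso_right i

lemma arrowGenerators_le {P : ObjectProperty C} (hP : P ≤ isCardinalPresentable C α) :
    arrowGenerators P ≤ isCardinalPresentable (Arrow C) α := by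
  rintro _ (⟨⟨G, hG⟩⟩ | ⟨⟨G, hG⟩⟩)
  · have : IsCardinalPresentable G α := hP _ hG
    exact isCardinalPresentable_arrow_id α G
  · have : IsCardinalPresentable G α := hP _ hG
    exact isCardinalPresentable_arrow_initial α G

lemma isCardinalPresentable_initial : IsCardinalPresentable (⊥_ C) α :=
  have (k : Discrete PEmpty.{1}) :
      IsCardinalPresentable ((Functor.empty.{0} C).obj k) α := k.as.elim
  isCardinalPresentable_of_isColimit _ (initialIsInitial (C := C)) α
    (hasCardinalLT_of_finite _ _ (Cardinal.IsRegular.aleph0_le Fact.out))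

lemma colimitsCardinalClosure_arrowGenerators_le {P : ObjectProperty C}
    (hP : P ≤ isCardinalPresentable C α) :
    (arrowGenerators P).colimitsCardinalClosure α ≤
      (isCardinalPresentable C α).inverseImage Arrow.leftFunc ⊓
      (isCardinalPresentable C α).inverseImage Arrow.rightFunc := by
  have hQ (J : Type w) [SmallCategory J] (hJ : HasCardinalLT (Arrow J) α) :
      ((isCardinalPresentable C α).inverseImage Arrow.leftFunc ⊓
        (isCardinalPresentable C α).inverseImage Arrow.rightFunc).IsClosedUnderColimitsOfShape
          J := by
    have : (isCardinalPresentable C α).IsClosedUnderColimitsOfShape J :=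
      isClosedUnderColimitsOfShape_isCardinalPresentable.{w, w, w, w, u} C hJ
    exact ⟨fun f ⟨p⟩ ↦ ⟨ObjectProperty.prop_of_isColimit _
      (isColimitOfPreserves Arrow.leftFunc p.isColimit) (fun j ↦ (p.prop_diag_obj j).1),
      ObjectProperty.prop_of_isColimit _
      (isColimitOfPreserves Arrow.rightFunc p.isColimit) (fun j ↦ (p.prop_diag_obj j).2)⟩⟩
  refine ObjectProperty.colimitsCardinalClosure_le _ _ hQ ?_
  rintro _ (⟨⟨G, hG⟩⟩ | ⟨⟨G, hG⟩⟩)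
  · exact ⟨hP _ hG, hP _ hG⟩
  · exact ⟨isCardinalPresentable_initial α, hP _ hG⟩

end

/-- In a locally `α`-presentable category, every morphism is an `α`-filtered colimit of morphisms
between `α`-presentable objects. -/
lemma exists_colimitPresentation_arrow [IsCardinalLocallyPresentable C α] (f : Arrow C) :
    ∃ (J : Type w) (_ : SmallCategory J) (_ : IsCardinalFiltered J α)
      (p : ColimitPresentation J f), ∀ j, IsCardinalPresentable (p.diag.obj j).left α ∧
        IsCardinalPresentable (p.diag.obj j).right α := by
  obtain ⟨P, _, hP, hP'⟩ :=
    (IsCardinalLocallyPresentable.iff_exists_isStrongGenerator C α).1 inferInstance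
  have : ObjectProperty.Small.{w} (arrowGenerators P) := by
    unfold arrowGenerators
    infer_instance
  have h := arrowGenerators_le α hP'
  have := (isStrongGenerator_arrowGenerators hP).isDense_colimitsCardinalClosure_ι h
  obtain ⟨J, _, _, ⟨p⟩⟩ := (IsCardinalFilteredGenerator.of_isDense_ι _ α
    (ObjectProperty.colimitsCardinalClosure_le_isCardinalPresentable _ h)).exists_colimitsOfShape f
  exact ⟨J, inferInstance, inferInstance, p.toColimitPresentation, fun j ↦
    colimitsCardinalClosure_arrowGenerators_le α hP' _ (p.prop_diag_obj j)⟩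

end ArrowPresentation

/-! ### Presentable morphisms are pushouts of morphisms between presentable objects -/

section PushoutDiagrams

variable {J : Type w} [SmallCategory J] {f : Arrow C}
  (p : ColimitPresentation J f)

/-- The source component of the `j`-th leg of a colimit presentation of an arrow. -/
def legLeft (j : J) : (p.diag.obj j).left ⟶ f.left := (p.ι.app j).left

/-- The target component of the `j`-th leg of a colimit presentation of an arrow. -/
def legRight (j : J) : (p.diag.obj j).right ⟶ f.right := (p.ι.app j).right

lemma legLeft_hom (j : J) : legLeft p j ≫ f.hom = (p.diag.obj j).hom ≫ legRight p j :=
  Arrow.w (p.ι.app j)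

lemma map_legLeft {i j : J} (u : i ⟶ j) : (p.diag.map u).left ≫ legLeft p j = legLeft p i :=
  (congr_arg CommaMorphism.left (p.ι.naturality u)).trans (Category.comp_id _)

lemma map_legRight {i j : J} (u : i ⟶ j) : (p.diag.map u).right ≫ legRight p j = legRight p i :=
  (congr_arg CommaMorphism.right (p.ι.naturality u)).trans (Category.comp_id _)

lemma map_left_hom {i j : J} (u : i ⟶ j) :
    (p.diag.map u).left ≫ (p.diag.obj j).hom = (p.diag.obj i).hom ≫ (p.diag.map u).right :=
  Arrow.w (p.diag.map u)

lemma map_comp_left {i j k : J} (u : i ⟶ j) (v : j ⟶ k) :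
    (p.diag.map (u ≫ v)).left = (p.diag.map u).left ≫ (p.diag.map v).left :=
  congr_arg CommaMorphism.left (p.diag.map_comp u v)

lemma map_comp_right {i j k : J} (u : i ⟶ j) (v : j ⟶ k) :
    (p.diag.map (u ≫ v)).right = (p.diag.map u).right ≫ (p.diag.map v).right :=
  congr_arg CommaMorphism.right (p.diag.map_comp u v)

lemma map_id_left (i : J) : (p.diag.map (𝟙 i)).left = 𝟙 _ :=
  congr_arg CommaMorphism.left (p.diag.map_id i)

lemma map_id_right (i : J) : (p.diag.map (𝟙 i)).right = 𝟙 _ :=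
  congr_arg CommaMorphism.right (p.diag.map_id i)

variable [HasColimitsOfSize.{w, w} C]

/-- The sources of a colimit presentation of an arrow have the source as their colimit. -/
noncomputable def isColimitLeft :
    IsColimit (Arrow.leftFunc.mapCocone (Cocone.mk _ p.ι)) :=
  isColimitOfPreserves Arrow.leftFunc p.isColimit

/-- The targets of a colimit presentation of an arrow have the target as their colimit. -/
noncomputable def isColimitRight :
    IsColimit (Arrow.rightFunc.mapCocone (Cocone.mk _ p.ι)) :=
  isColimitOfPreserves Arrow.rightFunc p.isColimit

lemma left_hom_ext {Z : C} {g h : f.left ⟶ Z} (H : ∀ j, legLeft p j ≫ g = legLeft p j ≫ h) :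
    g = h :=
  (isColimitLeft p).hom_ext H

lemma right_hom_ext {Z : C} {g h : f.right ⟶ Z} (H : ∀ j, legRight p j ≫ g = legRight p j ≫ h) :
    g = h :=
  (isColimitRight p).hom_ext H

lemma exists_right_desc {Z : C} (g : ∀ j, (p.diag.obj j).right ⟶ Z)
    (hg : ∀ i j (u : i ⟶ j), (p.diag.map u).right ≫ g j = g i) :
    ∃ l : f.right ⟶ Z, ∀ j, legRight p j ≫ l = g j :=
  ⟨(isColimitRight p).desc ⟨Z, {
    app := g
    naturality i j u := (hg i j u).trans (Category.comp_id _).symm }⟩, (isColimitRight p).fac _⟩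

/-- The object obtained from the source of `f` by attaching the `j`-th arrow. -/
noncomputable abbrev stage (j : J) : C := pushout (legLeft p j) (p.diag.obj j).hom

/-- The transition morphisms between the stages. -/
noncomputable def stageMap {i j : J} (u : i ⟶ j) : stage p i ⟶ stage p j :=
  pushout.desc (pushout.inl _ _) ((p.diag.map u).right ≫ pushout.inr _ _) (by
    rw [← reassoc_of% @map_left_hom, ← pushout.condition, reassoc_of% @map_legLeft])

lemma inl_stageMap {i j : J} (u : i ⟶ j) :
    pushout.inl _ _ ≫ stageMap p u = pushout.inl _ _ := pushout.inl_desc _ _ _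

lemma inr_stageMap {i j : J} (u : i ⟶ j) :
    pushout.inr _ _ ≫ stageMap p u = (p.diag.map u).right ≫ pushout.inr _ _ :=
  pushout.inr_desc _ _ _

/-- The arrows `f.left ⟶ stage p j`, as a diagram under the source of `f`. -/
noncomputable def stageFunctor : J ⥤ Under f.left where
  obj j := Under.mk (pushout.inl (legLeft p j) (p.diag.obj j).hom)
  map {i j} u := Under.homMk (stageMap p u) (inl_stageMap p u)
  map_id i := by
    apply Under.UnderMorphism.ext
    apply pushout.hom_ext
    · exact (inl_stageMap p _).trans (Category.comp_id _).symm
    · refine (inr_stageMap p _).trans ?_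
      rw [map_id_right]
      exact (Category.id_comp _).trans (Category.comp_id _).symm
  map_comp {i j k} u v := by
    apply Under.UnderMorphism.ext
    change stageMap p _ = stageMap p _ ≫ stageMap p _
    apply pushout.hom_ext
    · rw [reassoc_of% @inl_stageMap, inl_stageMap, inl_stageMap]
    · rw [reassoc_of% @inr_stageMap, inr_stageMap, inr_stageMap, map_comp_right, Category.assoc]

/-- The morphism from the `j`-th stage to the target of `f`. -/
noncomputable def stageHom (j : J) : stage p j ⟶ f.right :=
  pushout.desc f.hom (legRight p j) (legLeft_hom p j)

lemma inl_stageHom (j : J) : pushout.inl _ _ ≫ stageHom p j = f.hom := pushout.inl_desc _ _ _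

lemma inr_stageHom (j : J) : pushout.inr _ _ ≫ stageHom p j = legRight p j :=
  pushout.inr_desc _ _ _

/-- The cocone with vertex `f` under the diagram of stages. -/
noncomputable def stageCocone : Cocone (stageFunctor p) where
  pt := Under.mk f.hom
  ι :=
    { app j := Under.homMk (stageHom p j) (pushout.inl_desc _ _ _)
      naturality i j u := by
        apply Under.UnderMorphism.ext
        change stageMap p u ≫ stageHom p j = stageHom p i ≫ 𝟙 f.right
        apply pushout.hom_ext
        · rw [reassoc_of% @inl_stageMap, Category.comp_id, inl_stageHom, inl_stageHom]
        · rw [reassoc_of% @inr_stageMap, Category.comp_id, inr_stageHom, inr_stageHom, map_legRight] }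

/-- A morphism is the colimit, under its source, of the pushouts of the members of a presentation. -/
noncomputable def isColimitStageCocone : IsColimit (stageCocone p) := by
  refine IsColimit.ofExistsUnique (fun s ↦ ?_)
  let γ (j : J) : stage p j ⟶ s.pt.right := (s.ι.app j).right
  have hγ (j : J) : pushout.inl _ _ ≫ γ j = s.pt.hom := Under.w (s.ι.app j)
  have hγ' {i j : J} (u : i ⟶ j) : (p.diag.map u).right ≫ pushout.inr _ _ ≫ γ j =
      pushout.inr _ _ ≫ γ i := by
    have h : stageMap p u ≫ γ j = γ i := congr_arg CommaMorphism.right (s.w u)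
    rw [← h, reassoc_of% @inr_stageMap]
  obtain ⟨l, hl⟩ := exists_right_desc p (fun j ↦ pushout.inr _ _ ≫ γ j) (fun i j u ↦ hγ' u)
  have hl' : f.hom ≫ l = s.pt.hom := left_hom_ext p (fun j ↦ by
    rw [reassoc_of% @legLeft_hom, hl, ← pushout.condition_assoc, hγ])
  refine ⟨Under.homMk l hl', fun j ↦ ?_, fun m hm ↦ ?_⟩
  · apply Under.UnderMorphism.ext
    change stageHom p j ≫ l = γ j
    apply pushout.hom_ext
    · rw [reassoc_of% @inl_stageHom, hl', hγ]
    · rw [reassoc_of% @inr_stageHom, hl]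
  · apply Under.UnderMorphism.ext
    let m' : f.right ⟶ s.pt.right := m.right
    have h (j : J) : stageHom p j ≫ m' = γ j := congr_arg CommaMorphism.right (hm j)
    change m' = l
    refine right_hom_ext p (fun j ↦ ?_)
    rw [hl j, ← h, reassoc_of% @inr_stageHom]

/-- The object obtained from the source of the `k`-th arrow by attaching the `j`-th arrow along
a transition morphism. -/
noncomputable abbrev preStage {j k : J} (u : j ⟶ k) : C :=
  pushout (p.diag.map u).left (p.diag.obj j).hom

/-- The transition morphisms between the objects `preStage p u`. -/
noncomputable def preStageMap {j k l : J} (u : j ⟶ k) (v : k ⟶ l) (t : j ⟶ l) (h : u ≫ v = t) :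
    preStage p u ⟶ preStage p t :=
  pushout.desc ((p.diag.map v).left ≫ pushout.inl _ _) (pushout.inr _ _) (by
    subst h
    rw [← pushout.condition, reassoc_of% @map_comp_left])

lemma inl_preStageMap {j k l : J} (u : j ⟶ k) (v : k ⟶ l) (t : j ⟶ l) (h : u ≫ v = t) :
    pushout.inl _ _ ≫ preStageMap p u v t h = (p.diag.map v).left ≫ pushout.inl _ _ :=
  pushout.inl_desc _ _ _

lemma inr_preStageMap {j k l : J} (u : j ⟶ k) (v : k ⟶ l) (t : j ⟶ l) (h : u ≫ v = t) :
    pushout.inr _ _ ≫ preStageMap p u v t h = pushout.inr _ _ :=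
  pushout.inr_desc _ _ _

/-- The comparison morphism from `preStage p u` to the `j`-th stage. -/
noncomputable def preStageHom {j k : J} (u : j ⟶ k) : preStage p u ⟶ stage p j :=
  pushout.desc (legLeft p k ≫ pushout.inl _ _) (pushout.inr _ _) (by
    rw [reassoc_of% @map_legLeft, pushout.condition])

lemma inl_preStageHom {j k : J} (u : j ⟶ k) :
    pushout.inl _ _ ≫ preStageHom p u = legLeft p k ≫ pushout.inl _ _ :=
  pushout.inl_desc _ _ _

lemma inr_preStageHom {j k : J} (u : j ⟶ k) :
    pushout.inr _ _ ≫ preStageHom p u = pushout.inr _ _ :=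
  pushout.inr_desc _ _ _

/-- The diagram of the objects `preStage p u`, for a fixed source `j` of `u`. -/
noncomputable def preStageFunctor (j : J) : Under j ⥤ C where
  obj k := preStage p k.hom
  map {k l} v := preStageMap p k.hom v.right l.hom (Under.w v)
  map_id k := by
    apply pushout.hom_ext
    · refine (inl_preStageMap p _ _ _ _).trans ?_
      have h : (p.diag.map (𝟙 k.right)).left = 𝟙 _ := map_id_left p _
      refine (congr_arg (· ≫ pushout.inl _ _) h).trans ?_
      exact (Category.id_comp _).trans (Category.comp_id _).symm
    · exact (inr_preStageMap p _ _ _ _).trans (Category.comp_id _).symm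
  map_comp {k l m} v v' := by
    apply pushout.hom_ext
    · rw [inl_preStageMap, reassoc_of% @inl_preStageMap, inl_preStageMap, Under.comp_right, map_comp_left,
        Category.assoc]
    · rw [inr_preStageMap, reassoc_of% @inr_preStageMap, inr_preStageMap]

/-- The cocone with vertex `stage p j` under the diagram of the objects `preStage p u`. -/
noncomputable def preStageCocone (j : J) : Cocone (preStageFunctor p j) where
  pt := stage p j
  ι :=
    { app k := preStageHom p k.hom
      naturality k l v := by
        change preStageMap p k.hom v.right l.hom (Under.w v) ≫ preStageHom p _ =
          preStageHom p _ ≫ 𝟙 (stage p j)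
        apply pushout.hom_ext
        · rw [reassoc_of% @inl_preStageMap, inl_preStageHom, reassoc_of% @map_legLeft, Category.comp_id,
            inl_preStageHom]
        · rw [reassoc_of% @inr_preStageMap, inr_preStageHom, Category.comp_id, inr_preStageHom] }

/-- The `j`-th stage is the colimit of the objects `preStage p u`. -/
noncomputable def isColimitPreStageCocone [IsFiltered J] (j : J) :
    IsColimit (preStageCocone p j) := by
  have hf : IsColimit ((Arrow.leftFunc.mapCocone (Cocone.mk _ p.ι)).whisker (Under.forget j)) :=
    (Functor.Final.isColimitWhiskerEquiv (Under.forget j) _).symm (isColimitLeft p)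
  have ext {Z : C} {g h : f.left ⟶ Z} (H : ∀ k (_ : j ⟶ k), legLeft p k ≫ g = legLeft p k ≫ h) :
    g = h := hf.hom_ext (fun k ↦ H k.right k.hom)
  refine IsColimit.ofExistsUnique (fun s ↦ ?_)
  let γ {k : J} (u : j ⟶ k) : preStage p u ⟶ s.pt := s.ι.app (Under.mk u)
  have hγ {k l : J} (u : j ⟶ k) (v : k ⟶ l) (t : j ⟶ l) (h : u ≫ v = t) :
      preStageMap p u v t h ≫ γ t = γ u :=
    s.w (Under.homMk v h : Under.mk u ⟶ Under.mk t)
  obtain ⟨l, hl⟩ : ∃ l : f.left ⟶ s.pt, ∀ k (u : j ⟶ k),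
      legLeft p k ≫ l = pushout.inl _ _ ≫ γ u :=
    ⟨hf.desc ⟨s.pt, {
    app k := pushout.inl _ _ ≫ γ k.hom
    naturality k l v := by
      refine Eq.trans ?_ (Category.comp_id _).symm
      change (p.diag.map v.right).left ≫ pushout.inl _ _ ≫ γ l.hom = pushout.inl _ _ ≫ γ k.hom
      rw [← hγ k.hom v.right l.hom (Under.w v), reassoc_of% @inl_preStageMap] }⟩, fun k u ↦ hf.fac _ (Under.mk u)⟩
  have hr {k : J} (u : j ⟶ k) : pushout.inr _ _ ≫ γ u = pushout.inr _ _ ≫ γ (𝟙 j) := by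
    rw [← hγ (𝟙 j) u u (Category.id_comp u), reassoc_of% @inr_preStageMap]
  refine ⟨pushout.desc l (pushout.inr _ _ ≫ γ (𝟙 j)) ?_, fun k ↦ ?_, fun m hm ↦ ?_⟩
  · rw [hl j (𝟙 j), ← pushout.condition_assoc]
    exact (Category.id_comp _).symm.trans (congr_arg (· ≫ _) (map_id_left p j).symm)
  · change preStageHom p k.hom ≫ _ = γ k.hom
    apply pushout.hom_ext
    · rw [reassoc_of% @inl_preStageHom, pushout.inl_desc, hl k.right k.hom]
    · rw [reassoc_of% @inr_preStageHom, pushout.inr_desc]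
      exact (hr k.hom).symm
  · let m' : stage p j ⟶ s.pt := m
    have hm' {k : J} (u : j ⟶ k) : preStageHom p u ≫ m' = γ u := hm (Under.mk u)
    change m' = _
    apply pushout.hom_ext
    · rw [pushout.inl_desc]
      refine ext (fun k u ↦ ?_)
      rw [hl k u, ← hm' u, reassoc_of% @inl_preStageHom]
    · rw [pushout.inr_desc, ← hm', reassoc_of% @inr_preStageHom]

end PushoutDiagrams

section

variable {α : Cardinal.{w}} [Fact α.IsRegular] [LocallySmall.{w} C]

lemma isCardinalPresentable_pushout {X Y Z : C} (f : X ⟶ Y) (g : X ⟶ Z) [HasPushout f g]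
    [IsCardinalPresentable X α] [IsCardinalPresentable Y α] [IsCardinalPresentable Z α] :
    IsCardinalPresentable (pushout f g) α := by
  have (k : WalkingSpan) : IsCardinalPresentable ((span f g).obj k) α := by
    rcases k with _ | _ | _ <;> assumption
  exact isCardinalPresentable_of_isColimit _ (colimit.isColimit (span f g)) α
    (hasCardinalLT_of_finite _ _ (Cardinal.IsRegular.aleph0_le Fact.out))

lemma isCardinalPresentable_coequalizer {X Y : C} (f g : X ⟶ Y) [HasCoequalizer f g]
    [IsCardinalPresentable X α] [IsCardinalPresentable Y α] :
    IsCardinalPresentable (coequalizer f g) α := by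
  have (k : WalkingParallelPair) : IsCardinalPresentable ((parallelPair f g).obj k) α := by
    rcases k with _ | _ <;> assumption
  exact isCardinalPresentable_of_isColimit _ (colimit.isColimit (parallelPair f g)) α
    (hasCardinalLT_of_finite _ _ (Cardinal.IsRegular.aleph0_le Fact.out))

end

/-- Any `α`-presentable morphism `n : X ⟶ B` of a locally `α`-presentable category is a pushout of
a morphism between `α`-presentable objects.

Writing `n` as an `α`-filtered colimit of arrows `P j ⟶ Q j` between presentable objects exhibits
it as a colimit, under `X`, of the pushouts `X ⟶ X ⊔_{P j} Q j`; hence `n` is a retract of one of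
these. The corresponding idempotent of `X ⊔_{P j} Q j` descends to an endomorphism of
`P k ⊔_{P j} Q j` for `k` large, and its coequalizer with the identity is the required object. -/
lemma exists_isPushout_of_presentableMorphisms (α : Cardinal.{w}) [Fact α.IsRegular]
    [IsCardinalLocallyPresentable C α] {X B : C} (n : X ⟶ B) (hn : presentableMorphisms C α n) :
    ∃ (P R : C) (_ : IsCardinalPresentable P α) (_ : IsCardinalPresentable R α)
      (a : P ⟶ X) (q : P ⟶ R) (r : R ⟶ B), IsPushout a q n r := by
  obtain ⟨J, _, _, p, hp⟩ := exists_colimitPresentation_arrow α (Arrow.mk n)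
  have := isFiltered_of_isCardinalFiltered J α
  have hl (j : J) : IsCardinalPresentable (p.diag.obj j).left α := (hp j).1
  have hr (j : J) : IsCardinalPresentable (p.diag.obj j).right α := (hp j).2
  have : IsCardinalPresentable (Under.mk n) α := hn
  obtain ⟨j, s, hs₁, hs₂⟩ : ∃ (j : J) (s : B ⟶ stage p j), n ≫ s = pushout.inl _ _ ∧
      s ≫ stageHom p j = 𝟙 B := by
    obtain ⟨j, s, hs⟩ := IsCardinalPresentable.exists_hom_of_isColimit α
      (isColimitStageCocone p) (X := Under.mk n) (𝟙 _)
    exact ⟨j, s.right, Under.w s, congr_arg CommaMorphism.right hs⟩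
  have hc := isColimitPreStageCocone p j
  -- the idempotent of the `j`-th stage whose image is `n`
  let e : stage p j ⟶ stage p j := stageHom p j ≫ s
  have he : pushout.inl _ _ ≫ e = pushout.inl _ _ := by
    rw [reassoc_of% @inl_stageHom]
    exact hs₁
  -- the restriction of `e` to the target of the `j`-th arrow factors through some `preStage p u`,
  -- compatibly with the sources after enlarging `k`
  obtain ⟨k, u, t, ht₁, ht₂⟩ : ∃ (k : J) (u : j ⟶ k) (t : (p.diag.obj j).right ⟶ preStage p u),
      (p.diag.obj j).hom ≫ t = (p.diag.map u).left ≫ pushout.inl _ _ ∧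
      t ≫ preStageHom p u = pushout.inr _ _ ≫ e := by
    obtain ⟨k, t, ht⟩ : ∃ (k : Under j) (t : (p.diag.obj j).right ⟶ preStage p k.hom),
        t ≫ preStageHom p k.hom = pushout.inr _ _ ≫ e :=
      IsCardinalPresentable.exists_hom_of_isColimit α hc
        (pushout.inr (legLeft p j) (p.diag.obj j).hom ≫ e)
    obtain ⟨l, v, hv⟩ : ∃ (l : Under j) (v : k ⟶ l),
        ((p.diag.obj j).hom ≫ t) ≫ preStageMap p k.hom v.right l.hom (Under.w v) =
        ((p.diag.map k.hom).left ≫ pushout.inl _ _) ≫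
          preStageMap p k.hom v.right l.hom (Under.w v) :=
      IsCardinalPresentable.exists_eq_of_isColimit' α hc _ _ (by
        change ((p.diag.obj j).hom ≫ t) ≫ preStageHom p k.hom =
          ((p.diag.map k.hom).left ≫ pushout.inl _ _) ≫ preStageHom p k.hom
        rw [Category.assoc, ht, ← pushout.condition_assoc, he, Category.assoc, inl_preStageHom,
          reassoc_of% @map_legLeft])
    refine ⟨l.right, l.hom, t ≫ preStageMap p k.hom v.right l.hom (Under.w v), ?_, ?_⟩
    · rw [← Category.assoc, hv, Category.assoc, inl_preStageMap]
      have h : (p.diag.map l.hom).left =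
          (p.diag.map k.hom).left ≫ (p.diag.map v.right).left := by
        rw [← map_comp_left, Under.w]
      exact (Category.assoc _ _ _).symm.trans (congr_arg (· ≫ _) h.symm)
    · rw [← ht, Category.assoc]
      congr 1
      exact (preStageCocone p j).w v
  -- an endomorphism of `preStage p u` that induces `e`; it need not be idempotent
  let ε : preStage p u ⟶ preStage p u := pushout.desc (pushout.inl _ _) t ht₁.symm
  have hε₁ : pushout.inl _ _ ≫ ε = pushout.inl _ _ := pushout.inl_desc _ _ _
  have hε₂ : pushout.inr _ _ ≫ ε = t := pushout.inr_desc _ _ _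
  have hε : ε ≫ preStageHom p u = preStageHom p u ≫ e := by
    apply pushout.hom_ext
    · rw [reassoc_of% hε₁, inl_preStageHom, reassoc_of% @inl_preStageHom, he]
    · rw [reassoc_of% hε₂, ht₂, reassoc_of% @inr_preStageHom]
  let R := coequalizer ε (𝟙 _)
  let π : preStage p u ⟶ R := coequalizer.π ε (𝟙 _)
  have hπ : ε ≫ π = π := (coequalizer.condition ε (𝟙 _)).trans (Category.id_comp _)
  have hes : e ≫ stageHom p j = stageHom p j := by
    change (stageHom p j ≫ s) ≫ stageHom p j = _
    rw [Category.assoc, hs₂]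
    exact Category.comp_id _
  let ρ : R ⟶ B := coequalizer.desc (preStageHom p u ≫ stageHom p j) (by
    rw [← Category.assoc, hε, Category.assoc, hes, Category.id_comp])
  have hρ : π ≫ ρ = preStageHom p u ≫ stageHom p j := coequalizer.π_desc _ _
  have : IsCardinalPresentable (preStage p u) α := isCardinalPresentable_pushout _ _
  refine ⟨(p.diag.obj k).left, R, hl k, isCardinalPresentable_coequalizer _ _, legLeft p k,
    pushout.inl _ _ ≫ π, ρ, isPushout_of_existsUnique ?_ (fun Z h l hw ↦ ?_)⟩
  · rw [Category.assoc, hρ, reassoc_of% @inl_preStageHom, inl_stageHom]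
    rfl
  · obtain ⟨d, hd₁, hd₂⟩ : ∃ d : stage p j ⟶ Z, pushout.inl _ _ ≫ d = h ∧
        pushout.inr _ _ ≫ d = pushout.inr _ _ ≫ π ≫ l :=
      ⟨pushout.desc h (pushout.inr _ _ ≫ π ≫ l) (by
        rw [← pushout.condition_assoc, ← map_legLeft p u, Category.assoc, hw, Category.assoc]),
        pushout.inl_desc _ _ _, pushout.inr_desc _ _ _⟩
    have hd : preStageHom p u ≫ d = π ≫ l := by
      apply pushout.hom_ext
      · rw [reassoc_of% @inl_preStageHom, hd₁, hw, Category.assoc]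
      · rw [reassoc_of% @inr_preStageHom, hd₂]
    refine ⟨s ≫ d, ⟨?_, ?_⟩, fun m ⟨hm₁, hm₂⟩ ↦ ?_⟩
    · rw [← Category.assoc, hs₁, hd₁]
    · have : Epi π := inferInstanceAs (Epi (coequalizer.π _ _))
      rw [← cancel_epi π, reassoc_of% hρ]
      have h := hε =≫ d
      rw [Category.assoc, hd, reassoc_of% hπ, Category.assoc] at h
      rw [h]
      exact congr_arg (_ ≫ ·) (Category.assoc _ _ _).symm
    · have h : stageHom p j ≫ m = d := by
        apply pushout.hom_ext
        · rw [reassoc_of% @inl_stageHom, hd₁]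
          exact hm₁
        · rw [reassoc_of% @inr_stageHom, hd₂, ← hm₂, reassoc_of% hρ, reassoc_of% @inr_preStageHom,
            reassoc_of% @inr_stageHom]
      rw [← h, reassoc_of% hs₂]

/-! ### Terminal objects of locally presentable categories -/

/-- A locally presentable category has a terminal object. The colimit of the inclusion of
a small generating subcategory is weakly terminal, and the wide coequalizer of its endomorphisms is
then terminal. -/
lemma hasTerminal_of_isCardinalLocallyPresentable (α : Cardinal.{w}) [Fact α.IsRegular]
    [IsCardinalLocallyPresentable C α] : HasTerminal C := by
  obtain ⟨Q, _, hQ⟩ := HasCardinalFilteredGenerator.exists_small_generator C α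
  have : HasColimitsOfShape Q.FullSubcategory C :=
    hasColimitsOfShape_of_equivalence (equivSmallModel.{w} Q.FullSubcategory).symm
  have hT (X : C) : Nonempty (X ⟶ colimit Q.ι) := by
    obtain ⟨J, _, _, ⟨p⟩⟩ := hQ.exists_colimitsOfShape X
    exact ⟨p.isColimit.desc ⟨colimit Q.ι,
      { app j := colimit.ι Q.ι ⟨p.diag.obj j, p.prop_diag_obj j⟩
        naturality i j φ := (colimit.w Q.ι (ObjectProperty.homMk (p.diag.map φ) :
          (⟨p.diag.obj i, p.prop_diag_obj i⟩ : Q.FullSubcategory) ⟶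
            ⟨p.diag.obj j, p.prop_diag_obj j⟩)).trans (Category.comp_id _).symm }⟩⟩
  have : HasWideEqualizers.{w} Cᵒᵖ := fun _ ↦ inferInstance
  have := hasInitial_of_weakly_initial_and_hasWideEqualizers (T := Opposite.op (colimit Q.ι))
    (fun X ↦ ⟨(hT X.unop).some.op⟩)
  exact hasTerminal_of_hasInitial_op

/-! ### A small set of cells -/

/-- In a locally `α`-presentable category, all `α`-presentable morphisms are pushouts of the members
of a small family of morphisms between `α`-presentable objects. -/
lemma exists_small_family_of_cells (C : Type u) [Category.{w} C] (α : Cardinal.{w})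
    [Fact α.IsRegular] [IsCardinalLocallyPresentable C α] :
    ∃ (T : Type w) (P R : T → C) (p : ∀ t, P t ⟶ R t),
      (∀ t, IsCardinalPresentable (P t) α) ∧ (∀ t, IsCardinalPresentable (R t) α) ∧
      (∀ {X B : C} (n : X ⟶ B), presentableMorphisms C α n →
        ∃ (t : T) (a : P t ⟶ X) (r : R t ⟶ B), IsPushout a (p t) n r) := by
  obtain ⟨Q, _, h₁, h₂⟩ :=
    ObjectProperty.EssentiallySmall.exists_small_le (isCardinalPresentable C α)
  let ob (i : Shrink.{w} (Subtype Q)) : C := ((equivShrink (Subtype Q)).symm i).1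
  have hob (X : C) (hX : IsCardinalPresentable X α) : ∃ i, Nonempty (X ≅ ob i) := by
    obtain ⟨Y, hY, ⟨e⟩⟩ := h₂ _ hX
    refine ⟨equivShrink _ ⟨Y, hY⟩, ⟨e ≪≫ eqToIso ?_⟩⟩
    exact congr_arg Subtype.val ((equivShrink (Subtype Q)).symm_apply_apply ⟨Y, hY⟩).symm
  refine ⟨Σ i j, (ob i ⟶ ob j), fun t ↦ ob t.1, fun t ↦ ob t.2.1, fun t ↦ t.2.2,
    fun t ↦ h₁ _ ((equivShrink (Subtype Q)).symm t.1).2,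
    fun t ↦ h₁ _ ((equivShrink (Subtype Q)).symm t.2.1).2, fun n hn ↦ ?_⟩
  obtain ⟨P, R, hP, hR, a, q, r, h⟩ := exists_isPushout_of_presentableMorphisms α n hn
  obtain ⟨i, ⟨e⟩⟩ := hob P hP
  obtain ⟨j, ⟨e'⟩⟩ := hob R hR
  exact ⟨⟨i, j, e.inv ≫ q ≫ e'.hom⟩, e.inv ≫ a, e'.inv ≫ r,
    h.of_iso e (Iso.refl _) e' (Iso.refl _) (by simp) (by simp) (by simp) (by simp)⟩

/-! ### The morphisms with respect to which all objects of a class are injective -/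

section Injectors

variable (K : ObjectProperty C)

lemma injectors_eq_llp [HasTerminal C] :
    injectors K = (MorphismProperty.ofHoms (fun X : Subtype K ↦ terminal.from X.1)).llp := by
  ext A B n
  refine ⟨?_, fun h X hX u ↦ ?_⟩
  · rintro h _ _ _ ⟨X⟩
    refine ⟨fun {u v} sq ↦ ?_⟩
    obtain ⟨l, hl⟩ := h X.2 u
    exact ⟨⟨{ l := l, fac_left := hl, fac_right := terminal.hom_ext _ _ }⟩⟩
  · have := h _ (MorphismProperty.ofHoms.mk (⟨X, hX⟩ : Subtype K))
    have sq : CommSq u n (terminal.from X) (terminal.from B) := ⟨terminal.hom_ext _ _⟩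
    exact ⟨sq.lift, sq.fac_left⟩

lemma injectors_of_comp {X Y Z : C} {f : X ⟶ Y} {g : Y ⟶ Z} (h : injectors K (f ≫ g)) :
    injectors K f := fun _ hA u ↦ by
  obtain ⟨v, hv⟩ := h hA u
  exact ⟨g ≫ v, (Category.assoc _ _ _).symm.trans hv⟩

end Injectors

/-! ### Attaching all admissible cells -/

lemma exists_isPushout_of_comp {P R X B X' B' : C} {a : P ⟶ X} {q : P ⟶ R} {n : X ⟶ B}
    {r : R ⟶ B} (h : IsPushout a q n r) {g : X ⟶ X'} {n' : X' ⟶ B'} {r' : R ⟶ B'}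
    (h' : IsPushout (a ≫ g) q n' r') : ∃ m : B ⟶ B', r ≫ m = r' ∧ IsPushout g n n' m := by
  have hw : a ≫ g ≫ n' = q ≫ r' := (Category.assoc _ _ _).symm.trans h'.w
  refine ⟨h.desc (g ≫ n') r' hw, h.inr_desc _ _ _, ?_⟩
  refine IsPushout.of_left ?_ (h.inl_desc _ _ hw).symm h
  rwa [h.inr_desc]

section Cells

variable [HasColimitsOfSize.{w, w} C] {T : Type w} {P R : T → C} (p : ∀ t, P t ⟶ R t)
  (W : MorphismProperty C)

/-- The cells to be attached to the source of an arrow `f`: commutative squares from a member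
`p t` of the given family to `f`, such that the pushout of `p t` to the source of `f` belongs
to `W`. -/
structure Cell (f : Arrow C) where
  /-- the index of the attached morphism -/
  t : T
  /-- the attaching morphism -/
  base : P t ⟶ f.left
  /-- the morphism from the cell to the target -/
  top : R t ⟶ f.right
  w : base ≫ f.hom = p t ≫ top
  mem : W (pushout.inl base (p t))

variable {p W} in
/-- Cells are functorial, as `W` is stable under cobase change. -/
abbrev Cell.map [W.IsStableUnderCobaseChange] {f g : Arrow C} (c : Cell p W f) (φ : f ⟶ g) :
    Cell p W g where
  t := c.t
  base := c.base ≫ φ.left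
  top := c.top ≫ φ.right
  w := by rw [Category.assoc, Arrow.w φ, reassoc_of% c.w]
  mem := by
    obtain ⟨m, _, hm⟩ := exists_isPushout_of_comp (IsPushout.of_hasPushout c.base (p c.t))
      (IsPushout.of_hasPushout (c.base ≫ φ.left) (p c.t))
    exact W.of_isPushout hm c.mem

/-- The result of attaching all cells to the source of `f`. -/
noncomputable def cellObj (f : Arrow C) : C :=
  attach (fun c : Cell p W f ↦ p c.t) (fun c ↦ c.base)

/-- The inclusion of the source of `f`. -/
noncomputable def cellBase (f : Arrow C) : f.left ⟶ cellObj p W f :=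
  attachBase _ _

/-- The induced morphism to the target of `f`. -/
noncomputable def cellHom (f : Arrow C) : cellObj p W f ⟶ f.right :=
  attachDesc f.hom (fun c ↦ c.top) (fun c ↦ c.w.symm)

lemma cellBase_hom (f : Arrow C) : cellBase p W f ≫ cellHom p W f = f.hom :=
  attachBase_desc _ _ _

variable {p W} in
/-- The inclusion of a cell. -/
noncomputable def cellIncl {f : Arrow C} (c : Cell p W f) : R c.t ⟶ cellObj p W f :=
  attachCell (fun c : Cell p W f ↦ p c.t) (fun c ↦ c.base) c

lemma comp_cellIncl {f : Arrow C} (c : Cell p W f) :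
    p c.t ≫ cellIncl c = c.base ≫ cellBase p W f :=
  comp_attachCell (fun c : Cell p W f ↦ p c.t) (fun c ↦ c.base) c

lemma cellIncl_hom {f : Arrow C} (c : Cell p W f) : cellIncl c ≫ cellHom p W f = c.top :=
  attachCell_desc _ _ _ c

lemma cellIncl_congr {f : Arrow C} {t : T} {a a' : P t ⟶ f.left} {b b' : R t ⟶ f.right}
    (ha : a = a') (hb : b = b') (h₁ : a ≫ f.hom = p t ≫ b) (h₂ : a' ≫ f.hom = p t ≫ b')
    (h₃ : W (pushout.inl a (p t))) (h₄ : W (pushout.inl a' (p t))) :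
    cellIncl (⟨t, a, b, h₁, h₃⟩ : Cell p W f) = cellIncl (⟨t, a', b', h₂, h₄⟩ : Cell p W f) := by
  subst ha hb
  rfl

variable {p W} in
lemma cellObj_hom_ext {f : Arrow C} {Z : C} {g h : cellObj p W f ⟶ Z}
    (h₁ : cellBase p W f ≫ g = cellBase p W f ≫ h)
    (h₂ : ∀ c : Cell p W f, cellIncl c ≫ g = cellIncl c ≫ h) : g = h :=
  attach_hom_ext h₁ h₂

variable [W.IsStableUnderCobaseChange]

/-- The functoriality of `cellObj`. -/
noncomputable def cellMap {f g : Arrow C} (φ : f ⟶ g) : cellObj p W f ⟶ cellObj p W g :=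
  attachDesc (φ.left ≫ cellBase p W g)
    (fun c ↦ cellIncl (c.map φ))
    (fun c ↦ (comp_cellIncl p W (c.map φ)).trans (Category.assoc _ _ _))

lemma cellBase_map {f g : Arrow C} (φ : f ⟶ g) :
    cellBase p W f ≫ cellMap p W φ = φ.left ≫ cellBase p W g :=
  attachBase_desc _ _ _

lemma cellIncl_map {f g : Arrow C} (φ : f ⟶ g) (c : Cell p W f) :
    cellIncl c ≫ cellMap p W φ = cellIncl (c.map φ) :=
  attachCell_desc _ _ _ c

lemma cellMap_hom {f g : Arrow C} (φ : f ⟶ g) :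
    cellMap p W φ ≫ cellHom p W g = cellHom p W f ≫ φ.right := by
  refine cellObj_hom_ext ?_ (fun c ↦ ?_)
  · rw [reassoc_of% @cellBase_map, cellBase_hom, reassoc_of% @cellBase_hom, Arrow.w]
  · rw [reassoc_of% @cellIncl_map, cellIncl_hom, reassoc_of% @cellIncl_hom]

lemma cellMap_id (f : Arrow C) : cellMap p W (𝟙 f) = 𝟙 _ := by
  refine cellObj_hom_ext ?_ (fun c ↦ ?_)
  · rw [cellBase_map, Category.comp_id]
    exact Category.id_comp _
  · rw [cellIncl_map, Category.comp_id]
    exact cellIncl_congr p W (Category.comp_id _) (Category.comp_id _) _ _ _ _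

lemma cellMap_comp {f g h : Arrow C} (φ : f ⟶ g) (ψ : g ⟶ h) :
    cellMap p W (φ ≫ ψ) = cellMap p W φ ≫ cellMap p W ψ := by
  refine cellObj_hom_ext ?_ (fun c ↦ ?_)
  · rw [cellBase_map, reassoc_of% @cellBase_map, cellBase_map, Arrow.comp_left, Category.assoc]
  · rw [cellIncl_map, reassoc_of% @cellIncl_map, cellIncl_map]
    exact cellIncl_congr p W (Category.assoc _ _ _).symm (Category.assoc _ _ _).symm _ _ _ _

/-! ### The transfinite iteration -/

/-- An object over the target functor, as an endofunctor of the category of arrows. -/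
def toArrowFunctor (F : Over (Arrow.rightFunc : Arrow C ⥤ C)) : Arrow C ⥤ Arrow C where
  obj f := Arrow.mk (F.hom.app f)
  map {f g} φ := Arrow.homMk (F.left.map φ) φ.right (F.hom.naturality φ)
  map_id f := by
    ext
    · exact F.left.map_id f
    · rfl
  map_comp φ ψ := by
    ext
    · exact F.left.map_comp φ ψ
    · rfl

/-- The result of attaching all cells to a functor over the target functor. Working over the target
functor keeps the targets of the arrows fixed during the iteration. -/
noncomputable def cellSucc (F : Over (Arrow.rightFunc : Arrow C ⥤ C)) :
    Over (Arrow.rightFunc : Arrow C ⥤ C) :=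
  Over.mk (Y :=
    { obj f := cellObj p W ((toArrowFunctor F).obj f)
      map φ := cellMap p W ((toArrowFunctor F).map φ)
      map_id f := by rw [CategoryTheory.Functor.map_id, cellMap_id]
      map_comp φ ψ := by rw [CategoryTheory.Functor.map_comp, cellMap_comp] })
    { app f := cellHom p W ((toArrowFunctor F).obj f)
      naturality f g φ := cellMap_hom p W ((toArrowFunctor F).map φ) }

/-- The inclusion of a functor over the target functor in the result of attaching all cells. -/
noncomputable def toCellSucc (F : Over (Arrow.rightFunc : Arrow C ⥤ C)) : F ⟶ cellSucc p W F :=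
  Over.homMk
    { app f := cellBase p W ((toArrowFunctor F).obj f)
      naturality f g φ := (cellBase_map p W ((toArrowFunctor F).map φ)).symm } (by
    ext f
    exact cellBase_hom p W ((toArrowFunctor F).obj f))

/-- The successor structure whose iteration attaches cells to the source functor. -/
noncomputable def cellSuccStruct :
    SmallObject.SuccStruct (Over (Arrow.rightFunc : Arrow C ⥤ C)) where
  X₀ := Over.mk Arrow.leftToRight
  succ := cellSucc p W
  toSucc := toCellSucc p W

/-- Evaluation at an arrow, for functors over the target functor. -/
def evalOver (f : Arrow C) : Over (Arrow.rightFunc : Arrow C ⥤ C) ⥤ C :=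
  Over.forget _ ⋙ (evaluation _ _).obj f

instance (f : Arrow C) : PreservesColimitsOfSize.{w, w} (evalOver f) := by
  unfold evalOver
  infer_instance

instance : HasColimitsOfSize.{w, w} (Over (Arrow.rightFunc : Arrow C ⥤ C)) :=
  ⟨fun _ _ ↦ inferInstance⟩

instance (f : Arrow C) (J : Type w) [LinearOrder J] :
    PreservesWellOrderContinuousOfShape J (evalOver f) where
  preservesColimitsOfShape _ _ := inferInstance

variable {N : MorphismProperty C}

/-- Attaching all cells at once is a transfinite composition of members of `N`. -/
lemma transfiniteCompositionsOfShape_of_prop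
    (hiso : ∀ ⦃Z Z' : C⦄ (n : Z ⟶ Z') [IsIso n], N n)
    (hN : ∀ (t : T) ⦃Z Z' : C⦄ (a : P t ⟶ Z) (n : Z ⟶ Z') (r : R t ⟶ Z'),
      IsPushout a (p t) n r → W n → N n)
    {F G : Over (Arrow.rightFunc : Arrow C ⥤ C)} {φ : F ⟶ G} (hφ : (cellSuccStruct p W).prop φ)
    (f : Arrow C) {J : Type w} [LinearOrder J] [SuccOrder J] [NoMaxOrder J] [OrderBot J]
    [WellFoundedLT J] {e : Cell p W (Arrow.mk (F.hom.app f)) → J} (he : Function.Injective e) :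
    N.transfiniteCompositionsOfShape J ((evalOver f).map φ) := by
  obtain ⟨F⟩ := hφ
  exact transfiniteCompositionsOfShape_attachBase
    (fun c : Cell p W (Arrow.mk (F.hom.app f)) ↦ p c.t) (fun c ↦ c.base) he hiso
    (fun c Z Z' g n r h ↦ hN _ _ _ _ h (by
      obtain ⟨m, _, hm⟩ := exists_isPushout_of_comp (IsPushout.of_hasPushout c.base (p c.t)) h
      exact W.of_isPushout hm c.mem))

lemma exists_extension_of_prop {F G : Over (Arrow.rightFunc : Arrow C ⥤ C)} {φ : F ⟶ G}
    (hφ : (cellSuccStruct p W).prop φ) (f : Arrow C) {t : T} (a : P t ⟶ F.left.obj f)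
    (b : R t ⟶ f.right) (hab : a ≫ F.hom.app f = p t ≫ b) (h : W (pushout.inl a (p t))) :
    ∃ r : R t ⟶ G.left.obj f, p t ≫ r = a ≫ φ.left.app f ∧ r ≫ G.hom.app f = b := by
  obtain ⟨F⟩ := hφ
  let c : Cell p W (Arrow.mk (F.hom.app f)) := ⟨t, a, b, hab, h⟩
  exact ⟨cellIncl c, comp_cellIncl p W c, cellIncl_hom p W c⟩

end Cells

section SmallObjectArgument

variable [HasColimitsOfSize.{w, w} C] {T : Type w} {P R : T → C} (p : ∀ t, P t ⟶ R t)
  (W : MorphismProperty C) [W.IsStableUnderCobaseChange] {N : MorphismProperty C}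

/-- Iterating the attachment of all admissible cells yields functorial factorizations.

The second factor has the right lifting property: given `n` in `N` whose source maps to the colimit
of the iteration, `n` is a pushout of some `p t`, and its attaching morphism factors through an
earlier stage, as `P t` is `α`-presentable. The pushout of `p t` to that stage belongs to `W` by
left cancellation, so the cell has been attached at the next stage. -/
theorem hasFunctorialFactorization_of_cells
    [MorphismProperty.IsStableUnderTransfiniteComposition.{w} W]
    (hcancel : ∀ ⦃X Y Z : C⦄ (f : X ⟶ Y) (g : Y ⟶ Z), W (f ≫ g) → W f)
    (α : Cardinal.{w}) [Fact α.IsRegular] (hP : ∀ t, IsCardinalPresentable (P t) α)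
    (hiso : ∀ ⦃Z Z' : C⦄ (n : Z ⟶ Z') [IsIso n], N n)
    (hN : ∀ (t : T) ⦃Z Z' : C⦄ (a : P t ⟶ Z) (n : Z ⟶ Z') (r : R t ⟶ Z'),
      IsPushout a (p t) n r → W n → N n)
    (hN' : ∀ ⦃Z Z' : C⦄ (n : Z ⟶ Z'), N n →
      W n ∧ ∃ (t : T) (a : P t ⟶ Z) (r : R t ⟶ Z'), IsPushout a (p t) n r) :
    MorphismProperty.HasFunctorialFactorization
      (MorphismProperty.transfiniteCompositions.{w} N) N.rlp := by
  let J := α.ord.ToType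
  have : Nonempty J := by
    rw [← Cardinal.mk_ne_zero_iff, Cardinal.mk_ord_toType]
    exact (Cardinal.IsRegular.pos Fact.out).ne'
  let _ : OrderBot J := WellFoundedLT.toOrderBot _
  have hα : NoMaxOrder J := Cardinal.noMaxOrder (Cardinal.IsRegular.aleph0_le Fact.out)
  have : IsCardinalFiltered J α := inferInstance
  have : IsFiltered J := isFiltered_of_isCardinalFiltered J α
  let Φ := cellSuccStruct p W
  let c := Φ.transfiniteCompositionOfShapeιIteration J
  let Z := Φ.iteration J
  have hsucc (j : J) : Φ.prop (c.F.map (homOfLE (Order.le_succ j))) := c.map_mem j (not_isMax j)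
  -- a common index type for the cells attached at the various stages
  have key (f : Arrow C) : ∃ (J₀ : Type w) (_ : LinearOrder J₀) (_ : SuccOrder J₀)
      (_ : OrderBot J₀) (_ : WellFoundedLT J₀) (_ : NoMaxOrder J₀),
      ∀ j : J, ∃ e : Cell p W (Arrow.mk ((c.F.obj j).hom.app f)) → J₀, Function.Injective e := by
    let S := Σ j : J, Cell p W (Arrow.mk ((c.F.obj j).hom.app f))
    let μ : Cardinal.{w} := max Cardinal.aleph0 (Cardinal.mk S)
    have hμ : Cardinal.aleph0 ≤ μ := le_max_left _ _
    have : NoMaxOrder μ.ord.ToType := Cardinal.noMaxOrder hμ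
    have : Nonempty μ.ord.ToType := by
      rw [← Cardinal.mk_ne_zero_iff, Cardinal.mk_ord_toType]
      exact (Cardinal.aleph0_pos.trans_le hμ).ne'
    obtain ⟨e⟩ : Nonempty (S ↪ μ.ord.ToType) := by
      rw [← Cardinal.le_def, Cardinal.mk_ord_toType]
      exact le_max_right _ _
    exact ⟨μ.ord.ToType, inferInstance, inferInstance, WellFoundedLT.toOrderBot _, inferInstance,
      inferInstance, fun j ↦ ⟨fun x ↦ e ⟨j, x⟩, fun x y h ↦ 
      eq_of_heq (Sigma.mk.inj (e.injective h)).2⟩⟩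
  -- the chain of sources, for a fixed arrow `f`
  let cf (f : Arrow C) : TransfiniteCompositionOfShape J ((evalOver f).map (Φ.ιIteration J)) :=
    c.toTransfiniteCompositionOfShape.map (evalOver f)
  have hcf (f : Arrow C) : MorphismProperty.transfiniteCompositions.{w} N
      ((evalOver f).map (Φ.ιIteration J)) := by
    obtain ⟨J₀, _, _, _, _, _, he⟩ := key f
    choose e he using he
    exact transfiniteCompositions_of_lex (cf f) (fun j ↦
      (transfiniteCompositionsOfShape_of_prop p W hiso hN (hsucc j) f (he j)).some)
  have hW : MorphismProperty.transfiniteCompositions.{w} N ≤ W :=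
    (MorphismProperty.transfiniteCompositions_le_iff.{w}).2 (fun _ _ n hn ↦ (hN' n hn).1)
  let hcW (f : Arrow C) : W.TransfiniteCompositionOfShape J
      ((evalOver f).map (Φ.ιIteration J)) :=
    { __ := cf f
      map_mem := fun j _ ↦ by
        obtain ⟨J₀, _, _, _, _, _, he⟩ := key f
        obtain ⟨e, he⟩ := he j
        exact hW _ (MorphismProperty.transfiniteCompositionsOfShape_le_transfiniteCompositions _ _ _
          (transfiniteCompositionsOfShape_of_prop p W hiso hN (hsucc j) f he)) }
  refine ⟨⟨{ Z := Z.left, i := (Φ.ιIteration J).left, p := Z.hom, fac := Over.w (Φ.ιIteration J)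
             hi := hcf, hp := fun f A B n hn ↦ ⟨fun {x y} sq ↦ ?_⟩ }⟩⟩
  change B ⟶ f.right at y
  let X (j : J) : C := (c.F.obj j).left.obj f
  let ι (j : J) : X j ⟶ Z.left.obj f := (cf f).incl.app j
  have hι (j : J) : ι j = (c.incl.app j).left.app f := Category.comp_id _
  have hι_hom (j : J) : ι j ≫ Z.hom.app f = (c.F.obj j).hom.app f := by
    rw [hι]
    exact NatTrans.congr_app (Over.w (c.incl.app j)) f
  have hι_succ (j : J) : (c.F.map (homOfLE (Order.le_succ j))).left.app f ≫ ι (Order.succ j) =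
      ι j := ((cf f).incl.naturality (homOfLE (Order.le_succ j))).trans (Category.comp_id _)
  obtain ⟨hnW, t, a, r, h⟩ := hN' n hn
  have := hP t
  obtain ⟨j, b, hb⟩ : ∃ (j : J) (b : P t ⟶ X j), b ≫ ι j = a ≫ x :=
    IsCardinalPresentable.exists_hom_of_isColimit α (cf f).isColimit (a ≫ x)
  -- the cell is already admissible at the stage `j`, by left cancellation
  have hbW : W (pushout.inl b (p t)) := by
    obtain ⟨m, _, hm⟩ := exists_isPushout_of_comp h (IsPushout.of_hasPushout (a ≫ x) (p t))
    obtain ⟨m', _, hm'⟩ := exists_isPushout_of_comp (IsPushout.of_hasPushout b (p t))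
      (g := ι j) (n' := pushout.inl (a ≫ x) (p t)) (r' := pushout.inr (a ≫ x) (p t)) (by
        rw [hb]
        exact IsPushout.of_hasPushout (a ≫ x) (p t))
    refine hcancel _ m' ?_
    rw [← hm'.w]
    exact W.comp_mem _ _ ((hcW f).mem_incl_app j) (W.of_isPushout hm hnW)
  obtain ⟨l, hl₁, hl₂⟩ := exists_extension_of_prop p W (hsucc j) f b (r ≫ y) (by
    rw [← hι_hom, reassoc_of% hb, ← h.w_assoc]
    exact congr_arg (a ≫ ·) sq.w) hbW
  have hl₃ : a ≫ x = p t ≫ l ≫ ι (Order.succ j) := by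
    rw [reassoc_of% hl₁, hι_succ, hb]
  exact ⟨⟨{ l := h.desc x (l ≫ ι (Order.succ j)) hl₃
            fac_left := h.inl_desc _ _ _
            fac_right := by
              refine h.hom_ext ?_ ?_
              · rw [h.inl_desc_assoc]
                exact sq.w
              · rw [h.inr_desc_assoc, Category.assoc, hι_hom]
                exact hl₂ }⟩⟩

end SmallObjectArgument

/-! ### The weak factorization system -/

lemma le_underRetracts (N : MorphismProperty C) : N ≤ underRetracts N :=
  fun _ B f hf ↦ ⟨B, f, hf, ⟨Retract.refl _⟩⟩

lemma transfiniteCompositions_le_cofibrations (N : MorphismProperty C) :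
    MorphismProperty.transfiniteCompositions.{w} N ≤ cofibrations N :=
  (MorphismProperty.transfiniteCompositions_monotone N.le_pushouts).trans (le_underRetracts _)

lemma cofibrations_le_llp_rlp (N : MorphismProperty C) : cofibrations N ≤ N.rlp.llp := by
  rintro A B f ⟨B', g, hg, ⟨h⟩⟩
  have hg' : N.rlp.llp g :=
    (MorphismProperty.transfiniteCompositions_le_iff.{w}).2 N.pushouts_le_llp_rlp _ hg
  intro X Y q hq
  have := hg' q hq
  refine ⟨fun {u v} sq ↦ ?_⟩
  have hi : f ≫ h.i.right = g := Under.w h.i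
  have hr : g ≫ h.r.right = f := Under.w h.r
  have hir : h.i.right ≫ h.r.right = 𝟙 B := congr_arg CommaMorphism.right h.retract
  have sq' : CommSq u g q (h.r.right ≫ v) := ⟨by rw [reassoc_of% hr, sq.w]⟩
  exact ⟨⟨{ l := h.i.right ≫ sq'.lift
            fac_left := by rw [reassoc_of% hi, sq'.fac_left]
            fac_right := by
              rw [Category.assoc, sq'.fac_right, reassoc_of% hir]
              exact Category.id_comp v }⟩⟩

lemma cofibrations_eq_llp_rlp (N : MorphismProperty C)
    [MorphismProperty.HasFactorization (MorphismProperty.transfiniteCompositions.{w} N) N.rlp] :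
    cofibrations N = N.rlp.llp := by
  refine le_antisymm (cofibrations_le_llp_rlp N) (fun A B f hf ↦ ?_)
  let d := MorphismProperty.factorizationData
    (MorphismProperty.transfiniteCompositions.{w} N) N.rlp f
  have := hf d.p d.hp
  have sq : CommSq d.i f d.p (𝟙 B) := ⟨d.fac.trans (Category.comp_id _).symm⟩
  refine ⟨d.Z, d.i,
    MorphismProperty.transfiniteCompositions_monotone N.le_pushouts _ d.hi, ⟨?_⟩⟩
  exact
    { i := Under.homMk sq.lift sq.fac_left
      r := Under.homMk d.p d.fac
      retract := Under.UnderMorphism.ext sq.fac_right }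

lemma isWeakFactorizationSystem_cofibrations (N : MorphismProperty C)
    [MorphismProperty.HasFunctorialFactorization
      (MorphismProperty.transfiniteCompositions.{w} N) N.rlp] :
    MorphismProperty.IsWeakFactorizationSystem (cofibrations N) N.rlp ∧
      MorphismProperty.HasFunctorialFactorization (cofibrations N) N.rlp := by
  have : MorphismProperty.HasFunctorialFactorization (cofibrations N) N.rlp :=
    ⟨⟨(MorphismProperty.functorialFactorizationData
      (MorphismProperty.transfiniteCompositions.{w} N) N.rlp).ofLE
        (transfiniteCompositions_le_cofibrations N) le_rfl⟩⟩
  exact ⟨{ rlp := by rw [cofibrations_eq_llp_rlp, MorphismProperty.rlp_llp_rlp]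
           llp := (cofibrations_eq_llp_rlp N).symm }, this⟩

lemma injectives_iff_rlp [HasTerminal C] (N : MorphismProperty C) (X : C) :
    injectives N X ↔ N.rlp (terminal.from X) := by
  refine ⟨fun h A B n hn ↦ ⟨fun {u v} sq ↦ ?_⟩, fun h A B n hn u ↦ ?_⟩
  · obtain ⟨l, hl⟩ := h n hn u
    exact ⟨⟨{ l := l, fac_left := hl, fac_right := terminal.hom_ext _ _ }⟩⟩
  · have := h n hn
    have sq : CommSq u n (terminal.from X) (terminal.from B) := ⟨terminal.hom_ext _ _⟩
    exact ⟨sq.lift, sq.fac_left⟩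

lemma cofibrations_le_injectors [HasTerminal C] (N : MorphismProperty C) :
    cofibrations N ≤ injectors (injectives N) := by
  intro A B f hf X hX u
  have := cofibrations_le_llp_rlp N f hf _ ((injectives_iff_rlp N X).1 hX)
  have sq : CommSq u f (terminal.from X) (terminal.from B) := ⟨terminal.hom_ext _ _⟩
  exact ⟨sq.lift, sq.fac_left⟩

/-- The functorial factorization of the morphisms to the terminal object yields functorial weak
reflections. -/
lemma exists_functorial_weakReflection [HasTerminal C] (N : MorphismProperty C)
    [MorphismProperty.HasFunctorialFactorization (cofibrations N) N.rlp] :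
    ∃ (R : C ⥤ C) (r : 𝟭 C ⟶ R), ∀ A : C,
      injectives N (R.obj A) ∧ injectors (injectives N) (r.app A) := by
  let d := MorphismProperty.functorialFactorizationData (cofibrations N) N.rlp
  let G : C ⥤ Arrow C :=
    { obj A := Arrow.mk (terminal.from A)
      map φ := Arrow.homMk φ (𝟙 (⊤_ C)) (terminal.hom_ext _ _) }
  refine ⟨G ⋙ d.Z, { app A := d.i.app (G.obj A), naturality A B φ := d.i.naturality (G.map φ) },
    fun A ↦ ⟨(injectives_iff_rlp N _).2 ?_, cofibrations_le_injectors N _ (d.hi _)⟩⟩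
  have h : d.p.app (G.obj A) = terminal.from (d.Z.obj (G.obj A)) := terminal.hom_ext _ _
  exact h ▸ d.hp (G.obj A)

/-- An isomorphism is `α`-presentable, being a pushout of the identity of the initial object. -/
lemma presentableMorphisms_of_isIso (α : Cardinal.{w}) [Fact α.IsRegular]
    [HasColimitsOfSize.{w, w} C] {X Y : C} (n : X ⟶ Y) [IsIso n] : presentableMorphisms C α n := by
  have := isCardinalPresentable_initial (C := C) α
  exact presentableMorphisms_of_isPushout
    (IsPushout.of_vert_isIso ⟨initial.hom_ext _ _⟩ :
      IsPushout (initial.to X) (𝟙 (⊥_ C)) n (initial.to Y))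

lemma injectors_of_isIso (K : ObjectProperty C) {X Y : C} (n : X ⟶ Y) [IsIso n] :
    injectors K n := fun _ _ u ↦ ⟨inv n ≫ u, IsIso.hom_inv_id_assoc n u⟩

/-- For any class `K` of objects, the `α`-presentable morphisms with respect to which all members
of `K` are injective admit functorial factorizations. -/
lemma hasFunctorialFactorization_presentable_injectors (α : Cardinal.{w}) [Fact α.IsRegular]
    [IsCardinalLocallyPresentable C α] (K : ObjectProperty C) :
    MorphismProperty.HasFunctorialFactorization (MorphismProperty.transfiniteCompositions.{w}
      (presentableMorphisms C α ⊓ injectors K)) (presentableMorphisms C α ⊓ injectors K).rlp := by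
  have := hasTerminal_of_isCardinalLocallyPresentable (C := C) α
  have : (injectors K).IsStableUnderCobaseChange := by
    rw [injectors_eq_llp]
    infer_instance
  have : MorphismProperty.IsStableUnderTransfiniteComposition.{w} (injectors K) := by
    rw [injectors_eq_llp]
    infer_instance
  obtain ⟨T, P, R, p, hP, hR, hp⟩ := exists_small_family_of_cells C α
  exact hasFunctorialFactorization_of_cells p (injectors K)
    (fun _ _ _ _ _ h ↦ injectors_of_comp K h) α hP
    (fun _ _ n _ ↦ ⟨presentableMorphisms_of_isIso α n, injectors_of_isIso K n⟩)
    (fun t _ _ a n r h hn ↦ ⟨by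
      have := hP t
      have := hR t
      exact presentableMorphisms_of_isPushout h, hn⟩)
    (fun _ _ n hn ↦ ⟨hn.2, hp n hn.1⟩)

end WeakReflection

open WeakReflection in
theorem corollary1p5 {C : Type u} [Category.{w} C]
    (κ α : Cardinal.{w}) [Fact κ.IsRegular] [Fact α.IsRegular]
    [IsCardinalLocallyPresentable C κ] (hκα : κ ≤ α)
    (K : ObjectProperty C)
    (hK : WeakReflection.IsAlmostReflective K)
    (hKα : WeakReflection.IsMorphismInjectivityClass α K) :
    (∃ N : MorphismProperty C,
      N ≤ WeakReflection.presentableMorphisms C α ∧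
      MorphismProperty.IsWeakFactorizationSystem (WeakReflection.cofibrations N) N.rlp ∧
      MorphismProperty.HasFunctorialFactorization (WeakReflection.cofibrations N) N.rlp ∧
      K = WeakReflection.injectives N) ∧
    WeakReflection.IsFunctoriallyAlmostReflective K := by
  have := IsCardinalLocallyPresentable.of_le C hκα
  have := hasTerminal_of_isCardinalLocallyPresentable (C := C) α
  have := hasFunctorialFactorization_presentable_injectors α K
  obtain ⟨h₁, h₂⟩ := isWeakFactorizationSystem_cofibrations (presentableMorphisms C α ⊓ injectors K)
  have hN : K = injectives (presentableMorphisms C α ⊓ injectors K) := by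
    obtain ⟨M, hM, hKM⟩ := hKα
    refine le_antisymm (fun X hX A B n hn u ↦ hn.2 hX u) (fun X hX ↦ ?_)
    rw [hKM]
    refine fun A B m hm u ↦ hX m ⟨hM _ hm, fun Y hY v ↦ ?_⟩ u
    rw [hKM] at hY
    exact hY m hm v
  refine ⟨⟨_, inf_le_left, h₁, h₂, hN⟩, hK.1, ?_⟩
  obtain ⟨R, r, h⟩ := exists_functorial_weakReflection (presentableMorphisms C α ⊓ injectors K)
  rw [← hN] at h
  exact ⟨R, r, h⟩
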